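/- Let $r>0$. For a probability distribution $P$ on $\mathbb{R}$ with $\int |x|^r\,dP(x)<\infty$, an $L^r(P)$-optimal quantizer at level $n\ge 1$ is a nonempty set $\alpha_n\subset\mathbb{R}$ of at most $n$ points which minimizes $\big(\int_{\mathbb{R}} \min_{a\in\alpha}|x-a|^r\,dP(x)\big)^{1/r}$ among all nonempty sets $\alpha\subset\mathbb{R}$ of at most $n$ points; its maximal radius is $\rho_n=\max\{|a| : a\in\alpha_n\}$. (a) There is a real constant $C_r$ depending only on $r$ such that the following holds for every $\lambda>0$. Let $P$ be the exponential distribution with parameter $\lambda$ (density $\lambda e^{-\lambda x}\mathbf 1_{\{x\ge 0\}}$). Then for every $n\ge 1$ the $L^r(P)$-optimal quantizer $\alpha_n$ at level $n$ exists and is unique, and, as $n\to\infty$, $$\rho_n=\frac{r+1}{\lambda}\log n+\frac{C_r}{\lambda}+O\Big(\frac1n\Big).$$ (b) Let $\gamma>r$ and let $P$ be the Pareto distribution with index $\gamma$ (density $\gamma x^{-(\gamma+1)}\mathbf 1_{\{x>1\}}$). Then for every $n\ge 1$ the $L^r(P)$-optimal quantizer $\alpha_n$ at level $n$ exists and is unique,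 and there is a real constant $C_{r,\gamma}$, depending only on $r$ and $\gamma$, such that, as $n\to\infty$, $$\log\rho_n=\frac{r+1}{\gamma-r}\log n+C_{r,\gamma}+O\Big(\frac1n\Big).$$ -/

import Mathlib

open MeasureTheory ProbabilityTheory Filter Asymptotics
open scoped ENNReal NNReal

/-- The `L^r` quantization error `‖d(X, α)‖_r = (∫ d(x, α)^r dP(x))^{1/r}` (for `r > 0`) of the
finite grid `α`, for a random vector `X` with distribution `P`, with values in `[0, ∞]`. -/
noncomputable def quantizationError {E : Type*} [NormedAddCommGroup E] [MeasurableSpace E]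
    (r : ℝ) (P : Measure E) (α : Finset E) : ℝ≥0∞ :=
  eLpNorm (fun x : E => Metric.infDist x (α : Set E)) (ENNReal.ofReal r) P

/-- `α` is an `L^r(P)`-optimal quantizer at level `n`: a nonempty set of at most `n` points that
minimizes the `L^r` quantization error among all nonempty sets of at most `n` points. -/
def IsOptimalQuantizer {E : Type*} [NormedAddCommGroup E] [MeasurableSpace E]
    (r : ℝ) (P : Measure E) (n : ℕ) (α : Finset E) : Prop :=
  α.Nonempty ∧ α.card ≤ n ∧
    ∀ β : Finset E, β.Nonempty → β.card ≤ n → quantizationError r P α ≤ quantizationError r P β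

/-- The maximal radius `ρ(α) = max {|a| : a ∈ α}` of a (nonempty) quantizer `α`. -/
def maximalRadius {E : Type*} [NormedAddCommGroup E] (α : Finset E) : ℝ :=
  ((α.sup fun a => ‖a‖₊ : ℝ≥0) : ℝ)

/-! Let `S` be a standard exponential variable. The exponential and the Pareto laws are affine
images of the law of `stretch κ S`, with `κ = 0` and `κ = 1 / γ` respectively. Since
`stretch κ (s + t) = stretch κ s + exp (κ s) * stretch κ t` and `S` has no memory, the part of this
law beyond any cell boundary is an affine copy of the whole law. Optimal quantization is therefore
a dynamic programming problem: the best grid with `n + 2` points consists of a first cell,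
reaching `p (n + 1)` below and `q n` above the parameter of its point, and of a rescaled copy of
the best grid with `n + 1` points. The numbers `p n` and `q n` solve a one-dimensional recursion,
which determines them uniquely.

Expanding this recursion at `0` gives
`1 / p (n + 1) - 1 / p n = 2 (1 - κ r) / (r + 1) + O(p n ^ 2)`, hence
`p (n + 1) + q n = (r + 1) / (1 - κ r) / (n + 1) + O(1 / n ^ 2)`. Adding these numbers to `p 0`
gives the parameter of the largest point of the grid. For `κ > 0` that point grows like `exp (κ s)`
in its parameter `s`, which is why the Pareto case concerns `log ρ`. -/

open scoped Pointwise

/-- `stretch κ s = ∫₀ˢ exp (κ u) du`, that is `s` if `κ = 0` and `(exp (κ s) - 1) / κ` otherwise.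
The exponential and the Pareto distributions are affine images of the law of `stretch κ S` for a
standard exponential variable `S`, a generalized Pareto law with shape parameter `κ`. -/
noncomputable def stretch (κ s : ℝ) : ℝ := ∫ u in (0 : ℝ)..s, Real.exp (κ * u)

section Stretch

variable {κ s : ℝ}

theorem stretch_zero_left (s : ℝ) : stretch 0 s = s := by simp [stretch]

@[simp] theorem stretch_zero (κ : ℝ) : stretch κ 0 = 0 := by simp [stretch]

theorem hasDerivAt_stretch (κ s : ℝ) : HasDerivAt (stretch κ) (Real.exp (κ * s)) s := by
  have hc : Continuous fun u : ℝ => Real.exp (κ * u) := by fun_prop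
  exact (hc.integral_hasStrictDerivAt 0 s).hasDerivAt

@[fun_prop]
theorem continuous_stretch (κ : ℝ) : Continuous (stretch κ) :=
  continuous_iff_continuousAt.2 fun s => (hasDerivAt_stretch κ s).continuousAt

theorem strictMono_stretch (κ : ℝ) : StrictMono (stretch κ) :=
  strictMono_of_hasDerivAt_pos (fun s => hasDerivAt_stretch κ s) fun _ => Real.exp_pos _

theorem stretch_pos (hs : 0 < s) : 0 < stretch κ s := by
  simpa using strictMono_stretch κ hs

theorem stretch_nonneg (hs : 0 ≤ s) : 0 ≤ stretch κ s := by
  simpa using (strictMono_stretch κ).monotone hs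

theorem stretch_neg_of_neg (hs : s < 0) : stretch κ s < 0 := by
  simpa using strictMono_stretch κ hs

theorem stretch_add (κ s t : ℝ) :
    stretch κ (s + t) = stretch κ s + Real.exp (κ * s) * stretch κ t := by
  have hc : Continuous fun u : ℝ => Real.exp (κ * u) := by fun_prop
  have h := intervalIntegral.integral_comp_add_left (a := 0) (b := t)
    (fun u : ℝ => Real.exp (κ * u)) s
  simp only [mul_add, Real.exp_add, intervalIntegral.integral_const_mul, add_zero] at h
  simp only [stretch]
  rw [h, intervalIntegral.integral_add_adjacent_intervals] <;> exact hc.intervalIntegrable _ _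

theorem one_add_mul_stretch (κ s : ℝ) : 1 + κ * stretch κ s = Real.exp (κ * s) := by
  rcases eq_or_ne κ 0 with rfl | hκ
  · simp
  · rw [stretch, intervalIntegral.integral_comp_mul_left Real.exp hκ, integral_exp]
    simp [hκ]

theorem le_stretch (hκ : 0 ≤ κ) (hs : 0 ≤ s) : s ≤ stretch κ s := by
  have : ∫ _ in (0 : ℝ)..s, (1 : ℝ) ≤ stretch κ s :=
    intervalIntegral.integral_mono_on hs (by simp)
      ((by fun_prop : Continuous fun u : ℝ => Real.exp (κ * u)).intervalIntegrable _ _)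
      fun u hu => Real.one_le_exp (mul_nonneg hκ hu.1)
  simpa using this

theorem tendsto_stretch_atTop (hκ : 0 ≤ κ) : Tendsto (stretch κ) atTop atTop :=
  tendsto_atTop_mono' _ ((eventually_ge_atTop 0).mono fun _ h => le_stretch hκ h) tendsto_id

theorem exists_stretch_eq {y : ℝ} (h : 0 < 1 + κ * y) : ∃ s, stretch κ s = y := by
  rcases eq_or_ne κ 0 with rfl | hκ
  · exact ⟨y, stretch_zero_left y⟩
  · have := one_add_mul_stretch κ (Real.log (1 + κ * y) / κ)
    rw [mul_div_cancel₀ _ hκ, Real.exp_log h] at this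
    exact ⟨_, mul_left_cancel₀ hκ (add_left_cancel this)⟩

end Stretch

/-- The integral `∫₀ᶻ exp ((1 - κ r) v) |stretch κ v| ^ r dv`, whose increments are, up to a
factor, the contributions of the cells of a grid to its quantization error. -/
noncomputable def cellMoment (κ r z : ℝ) : ℝ :=
  ∫ v in (0 : ℝ)..z, Real.exp ((1 - κ * r) * v) * |stretch κ v| ^ r

/-- The balance function: a point of parameter `z` is stationary for its cell, between the
parameters `z - p` and `z + q`, exactly if `balance κ r p = balance κ r (-q)`. -/
noncomputable def balance (κ r z : ℝ) : ℝ :=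
  Real.exp ((1 - κ * r) * z) * |stretch κ z| ^ r - (1 - κ * r) * cellMoment κ r z

section Balance

variable {κ r : ℝ}

theorem continuous_cellMoment_integrand (κ : ℝ) (hr : 0 < r) :
    Continuous fun v => Real.exp ((1 - κ * r) * v) * |stretch κ v| ^ r :=
  Continuous.mul (by fun_prop) ((continuous_stretch κ).abs.rpow_const fun _ => Or.inr hr.le)

theorem hasDerivAt_cellMoment (κ : ℝ) (hr : 0 < r) (z : ℝ) :
    HasDerivAt (cellMoment κ r) (Real.exp ((1 - κ * r) * z) * |stretch κ z| ^ r) z :=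
  ((continuous_cellMoment_integrand κ hr).integral_hasStrictDerivAt 0 z).hasDerivAt

@[simp] theorem cellMoment_zero (κ r : ℝ) : cellMoment κ r 0 = 0 := by simp [cellMoment]

theorem balance_zero (κ : ℝ) (hr : 0 < r) : balance κ r 0 = 0 := by
  simp [balance, Real.zero_rpow hr.ne']

theorem continuous_balance (κ : ℝ) (hr : 0 < r) : Continuous (balance κ r) :=
  (continuous_cellMoment_integrand κ hr).sub (continuous_const.mul
    (continuous_iff_continuousAt.2 fun z => (hasDerivAt_cellMoment κ hr z).continuousAt))

theorem hasDerivAt_cellMoment_sub_exp (κ : ℝ) (hr : 0 < r) (y z : ℝ) :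
    HasDerivAt (fun z => (1 - κ * r) * cellMoment κ r z - Real.exp ((1 - κ * r) * z) * y)
      ((1 - κ * r) * Real.exp ((1 - κ * r) * z) * (|stretch κ z| ^ r - y)) z := by
  have hM := (hasDerivAt_cellMoment κ hr z).const_mul (1 - κ * r)
  have hE := (((hasDerivAt_id z).const_mul (1 - κ * r)).exp).mul_const y
  refine (hM.sub hE).congr_deriv ?_
  simp only [id, mul_one]
  ring

theorem cellMoment_sub_exp_lt_of_lt_abs_stretch (hr : 0 < r) (hκr : κ * r < 1) {a b y : ℝ}
    (hab : a < b) (hy : ∀ s ∈ Set.Ioo a b, y < |stretch κ s| ^ r) :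
    (1 - κ * r) * cellMoment κ r a - Real.exp ((1 - κ * r) * a) * y <
      (1 - κ * r) * cellMoment κ r b - Real.exp ((1 - κ * r) * b) * y := by
  refine strictMonoOn_of_deriv_pos (convex_Icc a b)
    (fun z _ => (hasDerivAt_cellMoment_sub_exp κ hr y z).continuousAt.continuousWithinAt) ?_
    (Set.left_mem_Icc.2 hab.le) (Set.right_mem_Icc.2 hab.le) hab
  intro z hz
  rw [interior_Icc] at hz
  rw [(hasDerivAt_cellMoment_sub_exp κ hr y z).deriv]
  exact mul_pos (mul_pos (by linarith) (Real.exp_pos _)) (by linarith [hy z hz])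

theorem cellMoment_sub_exp_lt_of_abs_stretch_lt (hr : 0 < r) (hκr : κ * r < 1) {a b y : ℝ}
    (hab : a < b) (hy : ∀ s ∈ Set.Ioo a b, |stretch κ s| ^ r < y) :
    (1 - κ * r) * cellMoment κ r b - Real.exp ((1 - κ * r) * b) * y <
      (1 - κ * r) * cellMoment κ r a - Real.exp ((1 - κ * r) * a) * y := by
  refine strictAntiOn_of_deriv_neg (convex_Icc a b)
    (fun z _ => (hasDerivAt_cellMoment_sub_exp κ hr y z).continuousAt.continuousWithinAt) ?_
    (Set.left_mem_Icc.2 hab.le) (Set.right_mem_Icc.2 hab.le) hab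
  intro z hz
  rw [interior_Icc] at hz
  rw [(hasDerivAt_cellMoment_sub_exp κ hr y z).deriv]
  exact mul_neg_of_pos_of_neg (mul_pos (by linarith) (Real.exp_pos _)) (by linarith [hy z hz])

theorem abs_stretch_rpow_lt_of_nonneg (hr : 0 < r) {s t : ℝ} (hs : 0 ≤ s) (hst : s < t) :
    |stretch κ s| ^ r < |stretch κ t| ^ r := by
  have hlt := strictMono_stretch κ hst
  rw [abs_of_nonneg (stretch_nonneg hs), abs_of_pos (stretch_pos (hs.trans_lt hst))]
  exact Real.rpow_lt_rpow (stretch_nonneg hs) hlt hr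

theorem abs_stretch_rpow_lt_of_nonpos (hr : 0 < r) {s t : ℝ} (ht : t ≤ 0) (hst : s < t) :
    |stretch κ t| ^ r < |stretch κ s| ^ r := by
  have hlt := strictMono_stretch κ hst
  refine Real.rpow_lt_rpow (abs_nonneg _) ?_ hr
  rw [abs_of_nonpos (by simpa using (strictMono_stretch κ).monotone ht),
    abs_of_neg (stretch_neg_of_neg (hst.trans_le ht))]
  exact neg_lt_neg hlt

theorem exp_mul_rpow_lt_add_balance (hr : 0 < r) (hκr : κ * r < 1) {p z : ℝ} (hp : 0 ≤ p)
    (hz : 0 ≤ z) (hne : z ≠ p) :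
    Real.exp ((1 - κ * r) * z) * |stretch κ p| ^ r <
      (1 - κ * r) * cellMoment κ r z + balance κ r p := by
  rw [balance]
  rcases hne.lt_or_gt with h | h
  · linarith [cellMoment_sub_exp_lt_of_abs_stretch_lt hr hκr h fun s hs =>
      abs_stretch_rpow_lt_of_nonneg (κ := κ) hr (hz.trans hs.1.le) hs.2]
  · linarith [cellMoment_sub_exp_lt_of_lt_abs_stretch hr hκr h fun s hs =>
      abs_stretch_rpow_lt_of_nonneg (κ := κ) hr hp hs.1]

theorem add_balance_lt_exp_mul_rpow (hr : 0 < r) (hκr : κ * r < 1) {p z : ℝ} (hp : p ≤ 0)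
    (hz : z ≤ 0) (hne : z ≠ p) :
    (1 - κ * r) * cellMoment κ r z + balance κ r p <
      Real.exp ((1 - κ * r) * z) * |stretch κ p| ^ r := by
  rw [balance]
  rcases hne.lt_or_gt with h | h
  · linarith [cellMoment_sub_exp_lt_of_lt_abs_stretch hr hκr h fun s hs =>
      abs_stretch_rpow_lt_of_nonpos (κ := κ) hr hp hs.2]
  · linarith [cellMoment_sub_exp_lt_of_abs_stretch_lt hr hκr h fun s hs =>
      abs_stretch_rpow_lt_of_nonpos (κ := κ) hr (hs.2.le.trans hz) hs.1]

theorem exp_mul_rpow_self (κ r p : ℝ) :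
    Real.exp ((1 - κ * r) * p) * |stretch κ p| ^ r =
      (1 - κ * r) * cellMoment κ r p + balance κ r p := by
  rw [balance, add_sub_cancel]

theorem exp_mul_rpow_le_add_balance (hr : 0 < r) (hκr : κ * r < 1) {p z : ℝ} (hp : 0 ≤ p)
    (hz : 0 ≤ z) :
    Real.exp ((1 - κ * r) * z) * |stretch κ p| ^ r ≤
      (1 - κ * r) * cellMoment κ r z + balance κ r p := by
  rcases eq_or_ne z p with rfl | hne
  · exact (exp_mul_rpow_self κ r z).le
  · exact (exp_mul_rpow_lt_add_balance hr hκr hp hz hne).le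

theorem add_balance_le_exp_mul_rpow (hr : 0 < r) (hκr : κ * r < 1) {p z : ℝ} (hp : p ≤ 0)
    (hz : z ≤ 0) :
    (1 - κ * r) * cellMoment κ r z + balance κ r p ≤
      Real.exp ((1 - κ * r) * z) * |stretch κ p| ^ r := by
  rcases eq_or_ne z p with rfl | hne
  · exact (exp_mul_rpow_self κ r z).ge
  · exact (add_balance_lt_exp_mul_rpow hr hκr hp hz hne).le

theorem rpow_lt_balance (hr : 0 < r) (hκr : κ * r < 1) {p : ℝ} (hp : 0 < p) :
    |stretch κ p| ^ r < balance κ r p := by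
  simpa using exp_mul_rpow_lt_add_balance hr hκr hp.le le_rfl hp.ne

theorem balance_lt_rpow (hr : 0 < r) (hκr : κ * r < 1) {p : ℝ} (hp : p < 0) :
    balance κ r p < |stretch κ p| ^ r := by
  simpa using add_balance_lt_exp_mul_rpow hr hκr hp.le le_rfl hp.ne'

theorem balance_pos_of_neg (hr : 0 < r) (hκr : κ * r < 1) {p : ℝ} (hp : p < 0) :
    0 < balance κ r p := by
  have h := add_balance_lt_exp_mul_rpow hr hκr le_rfl hp.le hp.ne
  rw [balance_zero κ hr, stretch_zero, abs_zero, Real.zero_rpow hr.ne', mul_zero, add_zero] at h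
  have : 0 ≤ Real.exp ((1 - κ * r) * p) * |stretch κ p| ^ r := by positivity
  rw [balance]
  linarith

theorem exists_balance_eq (hκ : 0 ≤ κ) (hr : 0 < r) (hκr : κ * r < 1) {y : ℝ} (hy : 0 < y) :
    ∃ p, 0 < p ∧ balance κ r p = y := by
  have htop : Tendsto (fun p => |stretch κ p| ^ r) atTop atTop :=
    (tendsto_rpow_atTop hr).comp (tendsto_abs_atTop_atTop.comp (tendsto_stretch_atTop hκ))
  obtain ⟨s, hys, hs⟩ := ((htop.eventually_ge_atTop y).and (eventually_gt_atTop 0)).exists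
  obtain ⟨p, hp, hpy⟩ := intermediate_value_Icc hs.le (continuous_balance κ hr).continuousOn
    (show y ∈ Set.Icc (balance κ r 0) (balance κ r s) from
      ⟨by rw [balance_zero κ hr]; exact hy.le, hys.trans (rpow_lt_balance hr hκr hs).le⟩)
  refine ⟨p, lt_of_le_of_ne hp.1 ?_, hpy⟩
  rintro rfl
  exact hy.ne ((balance_zero κ hr).symm.trans hpy)

end Balance

section InfDist

theorem infDist_vadd_smul {E : Type*} [NormedAddCommGroup E] [NormedSpace ℝ E] {c : ℝ}
    (hc : c ≠ 0) (d x : E) (s : Set E) :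
    Metric.infDist (d + c • x) (d +ᵥ c • s) = ‖c‖ * Metric.infDist x s := by
  rw [← infDist_smul₀ hc]
  exact Metric.infDist_image (isometry_vadd E d)

theorem infDist_insert {X : Type*} [PseudoMetricSpace X] {s : Set X} (hs : s.Nonempty) (x y : X) :
    Metric.infDist x (insert y s) = min (dist x y) (Metric.infDist x s) := by
  rw [Metric.infDist, Metric.infDist, Set.insert_eq, Metric.infEDist_union,
    Metric.infEDist_singleton, dist_edist]
  exact ENNReal.toReal_min (edist_ne_top x y) (Metric.infEDist_ne_top hs)

theorem infDist_insert_of_le_midpoint {x y t : ℝ} {s : Set ℝ} (hs : IsLeast s y) (hxy : x ≤ y)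
    (ht : t ≤ (x + y) / 2) : Metric.infDist t (insert x s) = |t - x| := by
  rw [infDist_insert ⟨y, hs.1⟩, Real.dist_eq, min_eq_left]
  refine (Metric.le_infDist ⟨y, hs.1⟩).2 fun b hb => ?_
  have hyb : y ≤ b := hs.2 hb
  rw [Real.dist_eq, abs_sub_comm t b]
  exact (abs_le.2 ⟨by linarith, by linarith⟩).trans (le_abs_self _)

theorem infDist_insert_of_midpoint_le {x y t : ℝ} {s : Set ℝ} (hs : IsLeast s y) (hxy : x ≤ y)
    (ht : (x + y) / 2 ≤ t) : Metric.infDist t (insert x s) = Metric.infDist t s := by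
  rw [infDist_insert ⟨y, hs.1⟩, Real.dist_eq, min_eq_right]
  refine (Metric.infDist_le_dist_of_mem hs.1).trans ?_
  rw [Real.dist_eq]
  exact (abs_le.2 ⟨by linarith, by linarith⟩).trans (le_abs_self _)

theorem coe_vadd_smul_eq_image (d c : ℝ) (α : Finset ℝ) :
    ((d +ᵥ c • α : Finset ℝ) : Set ℝ) = (fun t => d + c * t) '' α := by
  rw [Finset.coe_vadd_finset, Finset.coe_smul_finset, ← Set.image_smul, ← Set.image_vadd,
    Set.image_image]
  simp only [smul_eq_mul, vadd_eq_add]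

theorem monotone_add_mul {c : ℝ} (hc : 0 ≤ c) (d : ℝ) : Monotone fun t => d + c * t :=
  (monotone_mul_left_of_nonneg hc).const_add d

theorem isLeast_vadd_smul {c m : ℝ} {α : Finset ℝ} (hc : 0 ≤ c) (d : ℝ)
    (hα : IsLeast (α : Set ℝ) m) : IsLeast ((d +ᵥ c • α : Finset ℝ) : Set ℝ) (d + c * m) :=
  coe_vadd_smul_eq_image d c α ▸ (monotone_add_mul hc d).map_isLeast hα

theorem isGreatest_vadd_smul {c m : ℝ} {α : Finset ℝ} (hc : 0 ≤ c) (d : ℝ)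
    (hα : IsGreatest (α : Set ℝ) m) : IsGreatest ((d +ᵥ c • α : Finset ℝ) : Set ℝ) (d + c * m) :=
  coe_vadd_smul_eq_image d c α ▸ (monotone_add_mul hc d).map_isGreatest hα

end InfDist

/-- The `r`-th power of the quantization error of the grid `α` for `stretch κ S`,
with `S` a standard exponential variable. -/
noncomputable def distortion (κ r : ℝ) (α : Finset ℝ) : ℝ :=
  ∫ s in Set.Ioi 0, Metric.infDist (stretch κ s) (α : Set ℝ) ^ r * Real.exp (-s)

section Distortion

variable {κ r : ℝ}

theorem stretch_le_stretch {κ' s : ℝ} (h : κ ≤ κ') (hs : 0 ≤ s) : stretch κ s ≤ stretch κ' s :=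
  intervalIntegral.integral_mono_on hs
    ((by fun_prop : Continuous fun u : ℝ => Real.exp (κ * u)).intervalIntegrable _ _)
    ((by fun_prop : Continuous fun u : ℝ => Real.exp (κ' * u)).intervalIntegrable _ _)
    fun _ hu => Real.exp_le_exp.2 (mul_le_mul_of_nonneg_right h hu.1)

theorem stretch_le_exp_div (hκ : 0 < κ) (s : ℝ) : stretch κ s ≤ 1 / κ * Real.exp (κ * s) := by
  rw [one_div_mul_eq_div, le_div_iff₀ hκ]
  linarith [one_add_mul_stretch κ s]

theorem mul_exp_rpow_mul_exp_neg {c : ℝ} (hc : 0 ≤ c) (κ r s : ℝ) :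
    (c * Real.exp (κ * s)) ^ r * Real.exp (-s) = c ^ r * Real.exp (-(1 - κ * r) * s) := by
  rw [Real.mul_rpow hc (Real.exp_pos _).le, ← Real.exp_mul, mul_assoc, ← Real.exp_add]
  congr 2
  ring

theorem integrableOn_distortion (hκ : 0 ≤ κ) (hr : 0 < r) (hκr : κ * r < 1) {α : Finset ℝ}
    (hα : α.Nonempty) :
    IntegrableOn (fun s => Metric.infDist (stretch κ s) (α : Set ℝ) ^ r * Real.exp (-s))
      (Set.Ioi 0) := by
  obtain ⟨a, ha⟩ := hα
  obtain ⟨δ, hκδ, hδ⟩ := exists_between ((lt_div_iff₀ hr).2 hκr)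
  have hδ0 : 0 < δ := hκ.trans_lt hκδ
  have hδr : 0 < 1 - δ * r := by linarith [(lt_div_iff₀ hr).1 hδ]
  have hbound : ∀ s, 0 < s →
      Metric.infDist (stretch κ s) (α : Set ℝ) ≤ (1 / δ + |a|) * Real.exp (δ * s) := fun s hs =>
    calc Metric.infDist (stretch κ s) (α : Set ℝ) ≤ |stretch κ s - a| :=
          Metric.infDist_le_dist_of_mem (Finset.mem_coe.2 ha)
      _ ≤ stretch κ s + |a| := by simpa [abs_of_pos (stretch_pos hs)] using abs_sub (stretch κ s) a
      _ ≤ 1 / δ * Real.exp (δ * s) + |a| * Real.exp (δ * s) :=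
          add_le_add ((stretch_le_stretch hκδ.le hs.le).trans (stretch_le_exp_div hδ0 s))
            (le_mul_of_one_le_right (abs_nonneg a) (Real.one_le_exp (by positivity)))
      _ = (1 / δ + |a|) * Real.exp (δ * s) := by ring
  refine ((exp_neg_integrableOn_Ioi 0 hδr).const_mul ((1 / δ + |a|) ^ r)).mono' ?_ ?_
  · exact ((((Metric.continuous_infDist_pt _).comp (continuous_stretch κ)).rpow_const
      fun _ => Or.inr hr.le).mul (by fun_prop)).aestronglyMeasurable
  · refine (ae_restrict_mem measurableSet_Ioi).mono fun s hs => ?_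
    have h0 : 0 ≤ Metric.infDist (stretch κ s) (α : Set ℝ) := Metric.infDist_nonneg
    rw [Real.norm_of_nonneg (by positivity), ← mul_exp_rpow_mul_exp_neg (by positivity)]
    gcongr
    exact hbound s hs

theorem distortion_zero_pos (hκ : 0 ≤ κ) (hr : 0 < r) (hκr : κ * r < 1) :
    0 < distortion κ r {0} := by
  have hint := integrableOn_distortion hκ hr hκr (Finset.singleton_nonempty 0)
  have hpos : ∀ s, 0 < s →
      0 < Metric.infDist (stretch κ s) (({0} : Finset ℝ) : Set ℝ) ^ r * Real.exp (-s) := by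
    intro s hs
    have : 0 < |stretch κ s| := abs_pos.2 (stretch_pos hs).ne'
    simp only [Finset.coe_singleton, Metric.infDist_singleton, dist_zero_right, Real.norm_eq_abs]
    positivity
  rw [distortion, setIntegral_pos_iff_support_of_nonneg_ae
    ((ae_restrict_mem measurableSet_Ioi).mono fun s hs => (hpos s hs).le) hint]
  exact lt_of_lt_of_le (by simp) (measure_mono (s := Set.Ioi (0 : ℝ)) fun s hs =>
    ⟨(hpos s hs).ne', hs⟩)

theorem mul_distortion_zero_le (hκ : 0 < κ) (hr : 0 < r) (hκr : κ * r < 1) :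
    (1 - κ * r) * distortion κ r {0} ≤ (1 / κ) ^ r := by
  have hθ : 0 < 1 - κ * r := by linarith
  calc (1 - κ * r) * distortion κ r {0}
      ≤ (1 - κ * r) * ∫ s in Set.Ioi 0, (1 / κ) ^ r * Real.exp (-(1 - κ * r) * s) := by
        refine mul_le_mul_of_nonneg_left (setIntegral_mono_on
          (integrableOn_distortion hκ.le hr hκr (Finset.singleton_nonempty 0))
          ((exp_neg_integrableOn_Ioi 0 hθ).const_mul _) measurableSet_Ioi fun s hs => ?_) hθ.le
        have hs0 := stretch_nonneg (κ := κ) (le_of_lt hs)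
        rw [← mul_exp_rpow_mul_exp_neg (by positivity), Finset.coe_singleton,
          Metric.infDist_singleton, dist_zero_right, Real.norm_of_nonneg hs0]
        gcongr
        exact stretch_le_exp_div hκ s
    _ = (1 / κ) ^ r := by
        rw [integral_const_mul, integral_exp_mul_Ioi (by linarith)]
        have := hθ.ne'
        simp only [mul_zero, Real.exp_zero]
        field_simp

theorem setIntegral_Ioi_comp_add (f : ℝ → ℝ) (a : ℝ) :
    ∫ s in Set.Ioi 0, f (s + a) = ∫ s in Set.Ioi a, f s := by
  simpa using (measurePreserving_add_right volume a).setIntegral_preimage_emb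
    (measurableEmbedding_addRight a) f (Set.Ioi a)

theorem setIntegral_Ioi_infDist_vadd_smul (κ r P : ℝ) (β : Finset ℝ) :
    ∫ s in Set.Ioi P, Metric.infDist (stretch κ s)
        ((stretch κ P +ᵥ Real.exp (κ * P) • β : Finset ℝ) : Set ℝ) ^ r * Real.exp (-s) =
      Real.exp (-((1 - κ * r) * P)) * distortion κ r β := by
  rw [← setIntegral_Ioi_comp_add, distortion, ← integral_const_mul]
  refine setIntegral_congr_fun measurableSet_Ioi fun s _ => ?_
  have hscale :=
    infDist_vadd_smul (Real.exp_pos (κ * P)).ne' (stretch κ P) (stretch κ s) (β : Set ℝ)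
  rw [smul_eq_mul, Real.norm_of_nonneg (Real.exp_pos _).le] at hscale
  rw [Finset.coe_vadd_finset, Finset.coe_smul_finset, add_comm s P, stretch_add, hscale,
    mul_comm (Real.exp _), neg_add, Real.exp_add, ← mul_assoc,
    mul_exp_rpow_mul_exp_neg Metric.infDist_nonneg, neg_mul]
  ring

theorem exp_mul_integral_abs_stretch_sub_rpow (κ r z P : ℝ) (hr : 0 < r) :
    Real.exp ((1 - κ * r) * z) *
        ∫ s in (0 : ℝ)..P, |stretch κ s - stretch κ z| ^ r * Real.exp (-s) =
      cellMoment κ r z - cellMoment κ r (z - P) := by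
  have hM := continuous_cellMoment_integrand κ hr
  rw [cellMoment, cellMoment, intervalIntegral.integral_interval_sub_left
    (hM.intervalIntegrable _ _) (hM.intervalIntegrable _ _)]
  have hsub := intervalIntegral.integral_comp_sub_left (a := 0) (b := P)
    (fun v => Real.exp ((1 - κ * r) * v) * |stretch κ v| ^ r) z
  rw [sub_zero] at hsub
  rw [← hsub, ← intervalIntegral.integral_const_mul]
  refine intervalIntegral.integral_congr fun s _ => ?_
  have hadd : stretch κ s - stretch κ z = -(stretch κ (z - s) * Real.exp (κ * s)) := by
    have := stretch_add κ s (z - s)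
    rw [add_sub_cancel] at this
    linarith
  rw [hadd, abs_neg, abs_mul, abs_of_pos (Real.exp_pos _),
    mul_exp_rpow_mul_exp_neg (abs_nonneg _), mul_left_comm, ← Real.exp_add, mul_comm,
    show (1 - κ * r) * z + -(1 - κ * r) * s = (1 - κ * r) * (z - s) by ring]

theorem exp_mul_distortion_eq_add (hκ : 0 ≤ κ) (hr : 0 < r) (hκr : κ * r < 1)
    {α β : Finset ℝ} (hα : α.Nonempty) {z P : ℝ} (hP : 0 ≤ P)
    (hcell : ∀ s, s ≤ P →
      Metric.infDist (stretch κ s) (α : Set ℝ) = |stretch κ s - stretch κ z|)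
    (htail : ∀ s, P ≤ s → Metric.infDist (stretch κ s) (α : Set ℝ) =
      Metric.infDist (stretch κ s)
        ((stretch κ P +ᵥ Real.exp (κ * P) • β : Finset ℝ) : Set ℝ)) :
    Real.exp ((1 - κ * r) * z) * distortion κ r α = cellMoment κ r z - cellMoment κ r (z - P) +
      Real.exp ((1 - κ * r) * (z - P)) * distortion κ r β := by
  have hint := integrableOn_distortion hκ hr hκr hα
  rw [distortion, ← intervalIntegral.integral_interval_add_Ioi hint
    (hint.mono_set (Set.Ioi_subset_Ioi hP)), mul_add, mul_sub (1 - κ * r), sub_eq_add_neg (_ * z),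
    Real.exp_add, mul_assoc, ← setIntegral_Ioi_infDist_vadd_smul]
  congr 2
  · rw [← exp_mul_integral_abs_stretch_sub_rpow κ r z P hr]
    congr 1
    refine intervalIntegral.integral_congr fun s hs => ?_
    rw [Set.uIcc_of_le hP] at hs
    simp only [hcell s hs.2]
  · refine setIntegral_congr_fun measurableSet_Ioi fun s hs => ?_
    simp only [htail s (le_of_lt hs)]

theorem exp_mul_distortion_singleton (hκ : 0 ≤ κ) (hr : 0 < r) (hκr : κ * r < 1) {z : ℝ}
    (hz : 0 ≤ z) : Real.exp ((1 - κ * r) * z) * distortion κ r {stretch κ z} =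
      cellMoment κ r z + distortion κ r {0} := by
  rw [exp_mul_distortion_eq_add hκ hr hκr (Finset.singleton_nonempty _) (z := z) (β := {0}) hz,
    sub_self, cellMoment_zero, sub_zero, mul_zero, Real.exp_zero, one_mul]
  · intro s _
    simp [Real.dist_eq]
  · intro s _
    simp

theorem distortion_image_max_zero_le (hκ : 0 ≤ κ) (hr : 0 < r) (hκr : κ * r < 1) {α : Finset ℝ}
    (hα : α.Nonempty) : distortion κ r (α.image (max · 0)) ≤ distortion κ r α := by
  refine setIntegral_mono_on (integrableOn_distortion hκ hr hκr (hα.image _))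
    (integrableOn_distortion hκ hr hκr hα) measurableSet_Ioi fun s hs => ?_
  have hs0 := stretch_nonneg (κ := κ) (le_of_lt hs)
  have hdist : Metric.infDist (stretch κ s) (α.image (max · 0) : Set ℝ) ≤
      Metric.infDist (stretch κ s) (α : Set ℝ) := by
    refine (Metric.le_infDist (Finset.coe_nonempty.2 hα)).2 fun a ha => ?_
    refine (Metric.infDist_le_dist_of_mem (Finset.mem_coe.2
      (Finset.mem_image_of_mem _ (Finset.mem_coe.1 ha)))).trans ?_
    simpa [Real.dist_eq, max_eq_left hs0] using abs_max_sub_max_le_abs (stretch κ s) a 0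
  have := Metric.infDist_nonneg (x := stretch κ s) (s := (α.image (max · 0) : Set ℝ))
  gcongr

end Distortion

/-- The grid with first point `stretch κ z` whose remaining points are an affine copy of `β`, chosen
so that by self-similarity `β` quantizes the law beyond `stretch κ (z + q)`. If the least point of
`β` is `-stretch κ (-q)`, the first cell ends exactly at `stretch κ (z + q)`. -/
noncomputable def prependPoint (κ z q : ℝ) (β : Finset ℝ) : Finset ℝ :=
  insert (stretch κ z) (stretch κ (z + q) +ᵥ Real.exp (κ * (z + q)) • β)

section PrependPoint

variable {κ r z q : ℝ} {β : Finset ℝ}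

theorem stretch_mem_prependPoint : stretch κ z ∈ prependPoint κ z q β :=
  Finset.mem_insert_self _ _

theorem card_prependPoint_le : (prependPoint κ z q β).card ≤ β.card + 1 := by
  refine (Finset.card_insert_le _ _).trans (Nat.succ_le_succ ?_)
  exact (Finset.card_image_le).trans Finset.card_image_le

theorem stretch_eq_add_neg (κ z q : ℝ) :
    stretch κ z = stretch κ (z + q) + Real.exp (κ * (z + q)) * stretch κ (-q) := by
  rw [← stretch_add, add_neg_cancel_right]

theorem exp_mul_distortion_prependPoint (hκ : 0 ≤ κ) (hr : 0 < r) (hκr : κ * r < 1) (hz : 0 ≤ z)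
    (hq : 0 ≤ q) (hβ : IsLeast (β : Set ℝ) (-stretch κ (-q))) :
    Real.exp ((1 - κ * r) * z) * distortion κ r (prependPoint κ z q β) =
      cellMoment κ r z - cellMoment κ r (-q) + Real.exp ((1 - κ * r) * -q) * distortion κ r β := by
  have hleast := isLeast_vadd_smul (Real.exp_pos (κ * (z + q))).le (stretch κ (z + q)) hβ
  have hmid : (stretch κ z + (stretch κ (z + q) + Real.exp (κ * (z + q)) * -stretch κ (-q))) / 2 =
      stretch κ (z + q) := by
    rw [stretch_eq_add_neg κ z q]
    ring
  have hle : stretch κ z ≤ stretch κ (z + q) + Real.exp (κ * (z + q)) * -stretch κ (-q) := by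
    linarith [(strictMono_stretch κ).monotone (le_add_of_nonneg_right hq : z ≤ z + q)]
  have hcells := exp_mul_distortion_eq_add (z := z) (P := z + q) (β := β) hκ hr hκr
    ⟨_, stretch_mem_prependPoint⟩ (by positivity)
    (fun s hs => by
      rw [prependPoint, Finset.coe_insert]
      exact infDist_insert_of_le_midpoint hleast hle
        (hmid.ge.trans' ((strictMono_stretch κ).monotone hs)))
    (fun s hs => by
      rw [prependPoint, Finset.coe_insert]
      exact infDist_insert_of_midpoint_le hleast hle
        (hmid.le.trans ((strictMono_stretch κ).monotone hs)))
  rwa [sub_add_cancel_left] at hcells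

theorem exists_vadd_smul_eq {c d m : ℝ} (hc : 0 < c) {α : Finset ℝ}
    (hα : IsLeast (α : Set ℝ) (d + c * m)) :
    ∃ β : Finset ℝ, IsLeast (β : Set ℝ) m ∧ β.card ≤ α.card ∧ d +ᵥ c • β = α := by
  have hmono : Monotone fun t => c⁻¹ * (t - d) := fun _ _ h => by dsimp only; gcongr
  refine ⟨α.image fun t => c⁻¹ * (t - d), ?_, Finset.card_image_le, ?_⟩
  · have h := hmono.map_isLeast hα
    rw [add_sub_cancel_left, inv_mul_cancel_left₀ hc.ne'] at h
    rwa [Finset.coe_image]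
  · rw [← Finset.coe_inj, coe_vadd_smul_eq_image, Finset.coe_image, Set.image_image]
    simp [hc.ne']

theorem exists_eq_prependPoint (hκ : 0 ≤ κ) {α : Finset ℝ} (hα : ∀ a ∈ α, 0 ≤ a)
    (hcard : 1 < α.card) :
    ∃ z q, ∃ β : Finset ℝ, 0 ≤ z ∧ 0 < q ∧ IsLeast (β : Set ℝ) (-stretch κ (-q)) ∧
      β.card < α.card ∧ α = prependPoint κ z q β := by
  have hne : α.Nonempty := Finset.card_pos.1 (zero_lt_one.trans hcard)
  set x := α.min' hne
  have hxα : x ∈ α := α.min'_mem hne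
  have hx0 : 0 ≤ x := hα x hxα
  obtain ⟨y, hy⟩ : ∃ y, IsLeast (α.erase x : Set ℝ) y := by
    refine ⟨_, (α.erase x).isLeast_min' ?_⟩
    rw [← Finset.card_pos, Finset.card_erase_of_mem hxα]
    omega
  have hxy : x < y := α.min'_lt_of_mem_erase_min' hne hy.1
  have hm0 : 0 ≤ (x + y) / 2 := by linarith
  obtain ⟨z, hz⟩ := exists_stretch_eq (by positivity : 0 < 1 + κ * x)
  obtain ⟨P, hP⟩ := exists_stretch_eq (by positivity : 0 < 1 + κ * ((x + y) / 2))
  have hz0 : 0 ≤ z := (strictMono_stretch κ).le_iff_le.1 (by rwa [stretch_zero, hz])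
  have hzP : z < P := (strictMono_stretch κ).lt_iff_lt.1 (by linarith)
  have hyP : y = stretch κ P + Real.exp (κ * P) * -stretch κ (-(P - z)) := by
    have h := stretch_eq_add_neg κ z (P - z)
    rw [add_sub_cancel, hz] at h
    linarith
  obtain ⟨β, hβ, hcardβ, hβα⟩ := exists_vadd_smul_eq (Real.exp_pos (κ * P)) (hyP ▸ hy)
  refine ⟨z, P - z, β, hz0, sub_pos.2 hzP, hβ, ?_, ?_⟩
  · exact hcardβ.trans_lt (Finset.card_erase_lt_of_mem hxα)
  · rw [prependPoint, add_sub_cancel, hz, hβα, Finset.insert_erase hxα]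

end PrependPoint

/-- The parameters of the optimal grids: in the parametrization by `stretch κ`, the cells of the
grid with `n + 1` points extend from `p k` below to `q (k - 1)` above the parameters of their
points, `k = n, …, 0`, the cell for `k = 0` being unbounded. -/
structure IsGridParam (κ r : ℝ) (p q : ℕ → ℝ) : Prop where
  p_pos : ∀ n, 0 < p n
  q_pos : ∀ n, 0 < q n
  balance_zero : balance κ r (p 0) = (1 - κ * r) * distortion κ r {0}
  neg_stretch_neg : ∀ n, -stretch κ (-q n) = stretch κ (p n)
  balance_succ : ∀ n, balance κ r (p (n + 1)) = balance κ r (-q n)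

/-- The grid with `n + 1` points given by the parameters `p`, `q`. -/
noncomputable def quantizerGrid (κ : ℝ) (p q : ℕ → ℝ) : ℕ → Finset ℝ
  | 0 => {stretch κ (p 0)}
  | n + 1 => prependPoint κ (p (n + 1)) (q n) (quantizerGrid κ p q n)

section GridParam

variable {κ r : ℝ}

theorem stretch_lt_of_balance_eq (hr : 0 < r) (hκr : κ * r < 1) {p q : ℝ} (hp : 0 < p)
    (hq : 0 < q) (h : balance κ r p = balance κ r (-q)) : stretch κ p < -stretch κ (-q) := by
  have hlt := (rpow_lt_balance hr hκr hp).trans_le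
    (h.trans_lt (balance_lt_rpow hr hκr (neg_lt_zero.2 hq))).le
  rw [Real.rpow_lt_rpow_iff (abs_nonneg _) (abs_nonneg _) hr, abs_of_pos (stretch_pos hp),
    abs_of_neg (stretch_neg_of_neg (neg_lt_zero.2 hq))] at hlt
  exact hlt

theorem exists_initial_param (hκ : 0 ≤ κ) (hr : 0 < r) (hκr : κ * r < 1) :
    ∃ p, 0 < p ∧ κ * stretch κ p < 1 ∧ balance κ r p = (1 - κ * r) * distortion κ r {0} := by
  obtain ⟨p, hp, hbal⟩ := exists_balance_eq hκ hr hκr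
    (mul_pos (by linarith : 0 < 1 - κ * r) (distortion_zero_pos hκ hr hκr))
  refine ⟨p, hp, ?_, hbal⟩
  rcases hκ.eq_or_lt with rfl | hκ
  · simp
  · have hlt := (rpow_lt_balance hr hκr hp).trans_le
      (hbal.trans_le (mul_distortion_zero_le hκ hr hκr))
    rw [Real.rpow_lt_rpow_iff (abs_nonneg _) (by positivity) hr, abs_of_pos (stretch_pos hp),
      lt_div_iff₀' hκ] at hlt
    exact hlt

theorem exists_next_param (hκ : 0 ≤ κ) (hr : 0 < r) (hκr : κ * r < 1) {p : ℝ} (hp : 0 < p)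
    (hκp : κ * stretch κ p < 1) :
    ∃ q p', 0 < q ∧ 0 < p' ∧ κ * stretch κ p' < 1 ∧ -stretch κ (-q) = stretch κ p ∧
      balance κ r p' = balance κ r (-q) := by
  obtain ⟨s, hs⟩ := exists_stretch_eq (show 0 < 1 + κ * -stretch κ p by linarith)
  have hs0 : s < 0 := (strictMono_stretch κ).lt_iff_lt.1 (by simpa [hs] using stretch_pos hp)
  obtain ⟨p', hp', hbal⟩ := exists_balance_eq hκ hr hκr (balance_pos_of_neg hr hκr hs0)
  refine ⟨-s, p', neg_pos.2 hs0, hp', ?_, by rw [neg_neg, hs, neg_neg], by rwa [neg_neg]⟩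
  have hlt := stretch_lt_of_balance_eq hr hκr hp' (neg_pos.2 hs0) (by rwa [neg_neg])
  rw [neg_neg, hs, neg_neg] at hlt
  exact (mul_le_mul_of_nonneg_left hlt.le hκ).trans_lt hκp

theorem exists_isGridParam (hκ : 0 ≤ κ) (hr : 0 < r) (hκr : κ * r < 1) :
    ∃ p q, IsGridParam κ r p q := by
  obtain ⟨p₀, hp₀, hκp₀, hbal₀⟩ := exists_initial_param hκ hr hκr
  have hnext := fun x : {x : ℝ // 0 < x ∧ κ * stretch κ x < 1} =>
    exists_next_param hκ hr hκr x.2.1 x.2.2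
  choose q p' hq hp' hκp' hlink hbal using hnext
  let x : ℕ → {x : ℝ // 0 < x ∧ κ * stretch κ x < 1} :=
    fun n => Nat.rec ⟨p₀, hp₀, hκp₀⟩ (fun _ x => ⟨p' x, hp' x, hκp' x⟩) n
  exact ⟨fun n => (x n).1, fun n => q (x n), fun n => (x n).2.1, fun n => hq (x n), hbal₀,
    fun n => hlink (x n), fun n => hbal (x n)⟩

namespace IsGridParam

variable {p q : ℕ → ℝ}

theorem p_succ_lt (h : IsGridParam κ r p q) (hr : 0 < r) (hκr : κ * r < 1) (n : ℕ) :
    p (n + 1) < p n := by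
  have hlt := stretch_lt_of_balance_eq hr hκr (h.p_pos (n + 1)) (h.q_pos n) (h.balance_succ n)
  rw [h.neg_stretch_neg] at hlt
  exact (strictMono_stretch κ).lt_iff_lt.1 hlt

theorem abs_stretch_neg (h : IsGridParam κ r p q) (n : ℕ) :
    |stretch κ (-q n)| = |stretch κ (p n)| := by
  rw [← h.neg_stretch_neg, abs_neg]

theorem isLeast_quantizerGrid (h : IsGridParam κ r p q) (n : ℕ) :
    IsLeast (quantizerGrid κ p q n : Set ℝ) (stretch κ (p n)) := by
  induction n with
  | zero => simp [quantizerGrid]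
  | succ n ih =>
    have hrest := isLeast_vadd_smul (Real.exp_pos (κ * (p (n + 1) + q n))).le
      (stretch κ (p (n + 1) + q n)) ih
    have hle : stretch κ (p (n + 1)) ≤ stretch κ (p (n + 1) + q n) +
        Real.exp (κ * (p (n + 1) + q n)) * stretch κ (p n) :=
      ((strictMono_stretch κ).monotone (by linarith [h.q_pos n])).trans
        (le_add_of_nonneg_right (mul_nonneg (Real.exp_pos _).le (stretch_pos (h.p_pos n)).le))
    rw [quantizerGrid, prependPoint, Finset.coe_insert]
    have hinsert := hrest.insert (stretch κ (p (n + 1)))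
    rwa [min_eq_left hle] at hinsert

theorem card_quantizerGrid_le (κ : ℝ) (p q : ℕ → ℝ) (n : ℕ) :
    (quantizerGrid κ p q n).card ≤ n + 1 := by
  induction n with
  | zero => simp [quantizerGrid]
  | succ n ih => exact card_prependPoint_le.trans (Nat.succ_le_succ ih)

theorem pos_of_mem_quantizerGrid (h : IsGridParam κ r p q) (n : ℕ) {a : ℝ}
    (ha : a ∈ quantizerGrid κ p q n) : 0 < a :=
  (stretch_pos (h.p_pos n)).trans_le ((h.isLeast_quantizerGrid n).2 ha)

theorem distortion_quantizerGrid (h : IsGridParam κ r p q) (hκ : 0 ≤ κ) (hr : 0 < r)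
    (hκr : κ * r < 1) (n : ℕ) :
    (1 - κ * r) * distortion κ r (quantizerGrid κ p q n) = |stretch κ (p n)| ^ r := by
  refine mul_left_cancel₀ (Real.exp_pos ((1 - κ * r) * p n)).ne' ?_
  rw [exp_mul_rpow_self, mul_left_comm]
  cases n with
  | zero =>
    rw [quantizerGrid, exp_mul_distortion_singleton hκ hr hκr (h.p_pos 0).le, h.balance_zero,
      mul_add]
  | succ n =>
    have hq := exp_mul_rpow_self κ r (-q n)
    rw [h.abs_stretch_neg, ← distortion_quantizerGrid h hκ hr hκr n, ← h.balance_succ] at hq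
    rw [quantizerGrid, exp_mul_distortion_prependPoint hκ hr hκr (h.p_pos _).le (h.q_pos n).le
      (h.neg_stretch_neg n ▸ h.isLeast_quantizerGrid n)]
    linear_combination hq

/-- One step of the dynamic programming argument: the first cell is optimal only for the parameters
`p (n + 1)` and `q n`. -/
theorem eq_of_distortion_prependPoint_le (h : IsGridParam κ r p q) (hκ : 0 ≤ κ) (hr : 0 < r)
    (hκr : κ * r < 1) {n : ℕ} {z q' : ℝ} {β : Finset ℝ} (hz : 0 ≤ z) (hq' : 0 < q')
    (hβ : IsLeast (β : Set ℝ) (-stretch κ (-q')))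
    (hopt : |stretch κ (p n)| ^ r ≤ (1 - κ * r) * distortion κ r β)
    (hle : (1 - κ * r) * distortion κ r (prependPoint κ z q' β) ≤ |stretch κ (p (n + 1))| ^ r) :
    z = p (n + 1) ∧ q' = q n ∧ (1 - κ * r) * distortion κ r β ≤ |stretch κ (p n)| ^ r := by
  have hD := exp_mul_distortion_prependPoint hκ hr hκr hz hq'.le hβ
  have hleD := mul_le_mul_of_nonneg_left hle (Real.exp_pos ((1 - κ * r) * z)).le
  have hDβ := mul_le_mul_of_nonneg_left hopt (Real.exp_pos ((1 - κ * r) * -q')).le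
  rw [mul_left_comm, hD] at hleD
  have hfirst := exp_mul_rpow_le_add_balance hr hκr (h.p_pos (n + 1)).le hz
  have hlast := add_balance_le_exp_mul_rpow hr hκr (neg_nonpos.2 (h.q_pos n).le)
    (neg_nonpos.2 hq'.le)
  rw [h.abs_stretch_neg, ← h.balance_succ] at hlast
  refine ⟨?_, ?_, ?_⟩
  · by_contra hne
    linarith [exp_mul_rpow_lt_add_balance hr hκr (h.p_pos (n + 1)).le hz hne]
  · by_contra hne
    have hlt := add_balance_lt_exp_mul_rpow hr hκr (neg_nonpos.2 (h.q_pos n).le)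
      (neg_nonpos.2 hq'.le) (neg_injective.ne hne)
    rw [h.abs_stretch_neg, ← h.balance_succ] at hlt
    linarith
  · refine le_of_mul_le_mul_left ?_ (Real.exp_pos ((1 - κ * r) * -q'))
    linarith

theorem abs_stretch_p_rpow_le (h : IsGridParam κ r p q) (hr : 0 < r) (hκr : κ * r < 1) (n : ℕ) :
    |stretch κ (p n)| ^ r ≤ |stretch κ (p 0)| ^ r := by
  rcases n.eq_zero_or_pos with rfl | hn
  · exact le_rfl
  · have hanti := strictAnti_nat_of_succ_lt fun n => h.p_succ_lt hr hκr n
    exact (abs_stretch_rpow_lt_of_nonneg hr (h.p_pos n).le (hanti hn)).le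

theorem eq_of_distortion_singleton_le (h : IsGridParam κ r p q) (hκ : 0 ≤ κ) (hr : 0 < r)
    (hκr : κ * r < 1) {n : ℕ} {a : ℝ} (ha : 0 ≤ a)
    (hle : (1 - κ * r) * distortion κ r {a} ≤ |stretch κ (p n)| ^ r) :
    n = 0 ∧ a = stretch κ (p 0) := by
  obtain ⟨z, rfl⟩ := exists_stretch_eq (by positivity : 0 < 1 + κ * a)
  have hz : 0 ≤ z := (strictMono_stretch κ).le_iff_le.1 (by rwa [stretch_zero])
  have hD := exp_mul_distortion_singleton hκ hr hκr hz
  have hanti := strictAnti_nat_of_succ_lt fun n => h.p_succ_lt hr hκr n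
  have hleD := mul_le_mul_of_nonneg_left hle (Real.exp_pos ((1 - κ * r) * z)).le
  rw [mul_left_comm, hD, mul_add, ← h.balance_zero] at hleD
  have hbound := exp_mul_rpow_le_add_balance hr hκr (h.p_pos 0).le hz
  have hmono := mul_le_mul_of_nonneg_left (h.abs_stretch_p_rpow_le hr hκr n)
    (Real.exp_pos ((1 - κ * r) * z)).le
  constructor
  · by_contra hn
    have hlt := mul_lt_mul_of_pos_left (abs_stretch_rpow_lt_of_nonneg (κ := κ) hr (h.p_pos n).le
      (hanti (Nat.pos_of_ne_zero hn))) (Real.exp_pos ((1 - κ * r) * z))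
    linarith
  · by_contra hne
    linarith [exp_mul_rpow_lt_add_balance hr hκr (h.p_pos 0).le hz
      fun hzp => hne (congrArg (stretch κ) hzp)]

theorem eq_quantizerGrid_of_nonneg (h : IsGridParam κ r p q) (hκ : 0 ≤ κ) (hr : 0 < r)
    (hκr : κ * r < 1) (n : ℕ) {α : Finset ℝ} (hne : α.Nonempty) (hα : ∀ a ∈ α, 0 ≤ a)
    (hcard : α.card ≤ n + 1) (hle : (1 - κ * r) * distortion κ r α ≤ |stretch κ (p n)| ^ r) :
    α = quantizerGrid κ p q n := by
  rcases hne.card_pos.nat_succ_le.eq_or_lt with hone | hlt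
  · obtain ⟨a, rfl⟩ := Finset.card_eq_one.1 hone.symm
    obtain ⟨rfl, rfl⟩ := h.eq_of_distortion_singleton_le hκ hr hκr (by simpa using hα) hle
    rfl
  obtain ⟨z, q', β, hz, hq', hβ, hβα, rfl⟩ := exists_eq_prependPoint hκ hα hlt
  cases n with
  | zero => omega
  | succ n =>
    have hgrid : (1 - κ * r) * distortion κ r β ≤ |stretch κ (p n)| ^ r →
        β = quantizerGrid κ p q n := h.eq_quantizerGrid_of_nonneg hκ hr hκr n ⟨_, hβ.1⟩
      (fun a ha => (neg_pos.2 (stretch_neg_of_neg (neg_neg_of_pos hq'))).le.trans (hβ.2 ha))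
      (by omega)
    have hopt : |stretch κ (p n)| ^ r ≤ (1 - κ * r) * distortion κ r β := by
      by_contra! hlt
      exact hlt.ne (hgrid hlt.le ▸ h.distortion_quantizerGrid hκ hr hκr n)
    obtain ⟨rfl, rfl, hβle⟩ := h.eq_of_distortion_prependPoint_le hκ hr hκr hz hq' hβ hopt hle
    rw [hgrid hβle, quantizerGrid]

theorem eq_quantizerGrid_of_distortion_le (h : IsGridParam κ r p q) (hκ : 0 ≤ κ) (hr : 0 < r)
    (hκr : κ * r < 1) (n : ℕ) {α : Finset ℝ} (hne : α.Nonempty) (hcard : α.card ≤ n + 1)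
    (hle : distortion κ r α ≤ distortion κ r (quantizerGrid κ p q n)) :
    α = quantizerGrid κ p q n := by
  have hclip : α.image (max · 0) = quantizerGrid κ p q n := by
    refine h.eq_quantizerGrid_of_nonneg hκ hr hκr n (hne.image _) ?_
      (Finset.card_image_le.trans hcard) ?_
    · simp
    · rw [← h.distortion_quantizerGrid hκ hr hκr]
      exact mul_le_mul_of_nonneg_left ((distortion_image_max_zero_le hκ hr hκr hne).trans hle)
        (by linarith)
  have hpos : ∀ a ∈ α, 0 < a := fun a ha => by
    have hmax := h.pos_of_mem_quantizerGrid n (hclip ▸ Finset.mem_image_of_mem (max · 0) ha)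
    simpa using hmax
  rw [← hclip]
  exact (Finset.image_id.symm.trans
    (Finset.image_congr fun a ha => (max_eq_left (hpos a ha).le).symm))

end IsGridParam

end GridParam

section AffineImage

variable {E : Type*} [NormedAddCommGroup E] [NormedSpace ℝ E] [MeasurableSpace E] [BorelSpace E]
  [DecidableEq E] {c : ℝ}

theorem quantizationError_map_vadd_smul (hc : c ≠ 0) (d : E) (r : ℝ) (P : Measure E)
    (α : Finset E) :
    quantizationError r (P.map fun x => d + c • x) (d +ᵥ c • α) =
      ‖c‖ₑ * quantizationError r P α := by
  rw [quantizationError, quantizationError, eLpNorm_map_measure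
    (Metric.continuous_infDist_pt _).measurable.aestronglyMeasurable
    (by fun_prop : Continuous fun x : E => d + c • x).measurable.aemeasurable]
  have hdist : ((fun x => Metric.infDist x ((d +ᵥ c • α : Finset E) : Set E)) ∘
      fun x => d + c • x) = ‖c‖ • fun x => Metric.infDist x (α : Set E) := by
    ext x
    rw [Function.comp_apply, Finset.coe_vadd_finset, Finset.coe_smul_finset,
      infDist_vadd_smul hc, Pi.smul_apply, smul_eq_mul]
  rw [hdist, eLpNorm_const_smul, enorm_norm]

theorem bijective_vadd_smul {E : Type*} [AddCommGroup E] [Module ℝ E] [DecidableEq E] (hc : c ≠ 0)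
    (d : E) : Function.Bijective fun α : Finset E => d +ᵥ c • α :=
  (AddAction.bijective d).comp (MulAction.bijective₀ hc)

theorem isOptimalQuantizer_map_vadd_smul_iff (hc : c ≠ 0) (d : E) {r : ℝ} {P : Measure E} {n : ℕ}
    {α : Finset E} :
    IsOptimalQuantizer r (P.map fun x => d + c • x) n (d +ᵥ c • α) ↔
      IsOptimalQuantizer r P n α := by
  have hmul : ‖c‖ₑ ≠ 0 := by simpa using hc
  rw [IsOptimalQuantizer, IsOptimalQuantizer, (bijective_vadd_smul hc d).surjective.forall]
  simp only [Finset.vadd_finset_nonempty, Finset.smul_finset_nonempty, Finset.card_vadd_finset,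
    Finset.card_smul_finset₀ hc, quantizationError_map_vadd_smul hc,
    ENNReal.mul_le_mul_iff_right hmul enorm_ne_top]

end AffineImage

section GenPareto

variable {κ r : ℝ}

theorem lintegral_withDensity_of_lt {x₀ : ℝ} {ρ g : ℝ → ℝ≥0∞} (hρ : Measurable ρ)
    (hg : Measurable g) (hρ0 : ∀ x < x₀, ρ x = 0) :
    ∫⁻ x, g x ∂volume.withDensity ρ = ∫⁻ x in Set.Ioi x₀, ρ x * g x := by
  rw [lintegral_withDensity_eq_lintegral_mul _ hρ hg, setLIntegral_congr Ioi_ae_eq_Ici,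
    setLIntegral_eq_of_support_subset]
  · rfl
  · intro x hx
    by_contra hlt
    exact hx (by simp [hρ0 x (not_le.1 hlt)])

/-- The generalized Pareto law with shape `κ`, location `0` and scale `1`, for `κ = 0` the standard
exponential law. -/
noncomputable def genPareto (κ : ℝ) : Measure ℝ :=
  (expMeasure 1).map (stretch κ)

theorem lintegral_genPareto (κ : ℝ) {g : ℝ → ℝ≥0∞} (hg : Measurable g) :
    ∫⁻ x, g x ∂genPareto κ =
      ∫⁻ s in Set.Ioi 0, ENNReal.ofReal (Real.exp (-s)) * g (stretch κ s) := by
  have hmeas := (continuous_stretch κ).measurable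
  rw [genPareto, lintegral_map hg hmeas]
  refine (lintegral_withDensity_of_lt (measurable_exponentialPDFReal 1).ennreal_ofReal
    (hg.comp hmeas) fun _ => exponentialPDF_of_neg).trans ?_
  refine setLIntegral_congr_fun measurableSet_Ioi fun s hs => ?_
  change exponentialPDF 1 s * g (stretch κ s) = _
  rw [exponentialPDF_of_nonneg (Set.mem_Ioi.1 hs).le, one_mul, one_mul]

theorem image_stretch_Ioi (hκ : 0 ≤ κ) {c : ℝ} (hc : 0 < c) (d : ℝ) :
    (fun s => d + c * stretch κ s) '' Set.Ioi 0 = Set.Ioi d := by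
  ext x
  refine ⟨?_, fun hx => ?_⟩
  · rintro ⟨s, hs, rfl⟩
    exact lt_add_of_pos_right d (mul_pos hc (stretch_pos hs))
  · have hy : 0 < (x - d) / c := div_pos (sub_pos.2 hx) hc
    obtain ⟨s, hs⟩ := exists_stretch_eq (by positivity : 0 < 1 + κ * ((x - d) / c))
    refine ⟨s, (strictMono_stretch κ).lt_iff_lt.1 (by rwa [stretch_zero, hs]), ?_⟩
    dsimp only
    rw [hs, mul_div_cancel₀ _ hc.ne', add_sub_cancel]

theorem map_genPareto_eq_withDensity (hκ : 0 ≤ κ) {c d : ℝ} (hc : 0 < c) {ρ : ℝ → ℝ≥0∞}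
    (hρ : Measurable ρ) (hρ0 : ∀ x < d, ρ x = 0)
    (h : ∀ s, 0 < s → ENNReal.ofReal (c * Real.exp (κ * s)) * ρ (d + c * stretch κ s) =
      ENNReal.ofReal (Real.exp (-s))) :
    (genPareto κ).map (fun x => d + c • x) = volume.withDensity ρ := by
  refine Measure.ext_of_lintegral _ fun g hg => ?_
  have haff : Measurable fun x : ℝ => d + c • x := by fun_prop
  rw [lintegral_map hg haff, lintegral_genPareto κ (g := fun x => g (d + c • x)) (hg.comp haff),
    lintegral_withDensity_of_lt hρ hg hρ0, ← image_stretch_Ioi hκ hc d,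
    lintegral_image_eq_lintegral_abs_deriv_mul measurableSet_Ioi
      (fun s _ => (((hasDerivAt_stretch κ s).const_mul c).const_add d).hasDerivWithinAt)
      (((add_right_injective d).comp ((mul_right_injective₀ hc.ne').comp
        (strictMono_stretch κ).injective)).injOn)]
  refine setLIntegral_congr_fun measurableSet_Ioi fun s hs => ?_
  rw [abs_of_pos (by positivity), ← mul_assoc, h s hs, smul_eq_mul]

theorem expMeasure_eq_map_genPareto {lam : ℝ} (hlam : 0 < lam) :
    expMeasure lam = (genPareto 0).map fun x => 0 + (1 / lam) • x := by
  refine (map_genPareto_eq_withDensity le_rfl (by positivity)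
    (measurable_exponentialPDFReal lam).ennreal_ofReal
    (fun _ => exponentialPDF_of_neg) fun s hs => ?_).symm
  change _ * exponentialPDF lam _ = _
  rw [stretch_zero_left, zero_add, exponentialPDF_of_nonneg (by positivity),
    ← ENNReal.ofReal_mul (by positivity)]
  congr 1
  simp only [zero_mul, Real.exp_zero]
  field_simp

theorem paretoMeasure_eq_map_genPareto {γ : ℝ} (hγ : 0 < γ) :
    paretoMeasure 1 γ = (genPareto (1 / γ)).map fun x => 1 + (1 / γ) • x := by
  refine (map_genPareto_eq_withDensity (by positivity) (by positivity)
    (measurable_paretoPDFReal 1 γ).ennreal_ofReal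
    (fun _ => paretoPDF_of_lt) fun s hs => ?_).symm
  change _ * paretoPDF 1 γ _ = _
  rw [one_add_mul_stretch, paretoPDF_of_le (Real.one_le_exp (by positivity)),
    ← ENNReal.ofReal_mul (by positivity), Real.one_rpow, ← Real.exp_mul]
  have hexp : 1 / γ * s * -(γ + 1) = -s - 1 / γ * s := by
    field_simp
    ring
  rw [hexp, Real.exp_sub]
  congr 1
  field_simp

theorem quantizationError_genPareto (hκ : 0 ≤ κ) (hr : 0 < r) (hκr : κ * r < 1) {α : Finset ℝ}
    (hα : α.Nonempty) :
    quantizationError r (genPareto κ) α = ENNReal.ofReal (distortion κ r α) ^ (1 / r) := by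
  rw [quantizationError, eLpNorm_eq_lintegral_rpow_enorm_toReal
    (ENNReal.ofReal_pos.2 hr).ne' ENNReal.ofReal_ne_top, ENNReal.toReal_ofReal hr.le,
    lintegral_genPareto κ ((Metric.continuous_infDist_pt _).measurable.enorm.pow_const r),
    distortion, ofReal_integral_eq_lintegral_ofReal (integrableOn_distortion hκ hr hκr hα)
      (Eventually.of_forall fun _ =>
        mul_nonneg (Real.rpow_nonneg Metric.infDist_nonneg r) (Real.exp_pos _).le)]
  congr 1
  refine setLIntegral_congr_fun measurableSet_Ioi fun s _ => ?_
  rw [Real.enorm_of_nonneg Metric.infDist_nonneg,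
    ENNReal.ofReal_rpow_of_nonneg Metric.infDist_nonneg hr.le,
    ← ENNReal.ofReal_mul (Real.exp_pos _).le, mul_comm]

theorem distortion_nonneg (α : Finset ℝ) : 0 ≤ distortion κ r α :=
  integral_nonneg fun _ => mul_nonneg (Real.rpow_nonneg Metric.infDist_nonneg r) (Real.exp_pos _).le

theorem quantizationError_genPareto_le_iff (hκ : 0 ≤ κ) (hr : 0 < r) (hκr : κ * r < 1)
    {α β : Finset ℝ} (hα : α.Nonempty) (hβ : β.Nonempty) :
    quantizationError r (genPareto κ) α ≤ quantizationError r (genPareto κ) β ↔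
      distortion κ r α ≤ distortion κ r β := by
  rw [quantizationError_genPareto hκ hr hκr hα, quantizationError_genPareto hκ hr hκr hβ,
    ENNReal.rpow_le_rpow_iff (by positivity), ENNReal.ofReal_le_ofReal_iff (distortion_nonneg β)]

theorem IsGridParam.isOptimalQuantizer_genPareto_iff {p q : ℕ → ℝ} (h : IsGridParam κ r p q)
    (hκ : 0 ≤ κ) (hr : 0 < r) (hκr : κ * r < 1) {n : ℕ} {α : Finset ℝ} :
    IsOptimalQuantizer r (genPareto κ) (n + 1) α ↔ α = quantizerGrid κ p q n := by
  have hgrid : (quantizerGrid κ p q n).Nonempty := ⟨_, (h.isLeast_quantizerGrid n).1⟩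
  constructor
  · rintro ⟨hne, hcard, hmin⟩
    refine h.eq_quantizerGrid_of_distortion_le hκ hr hκr n hne hcard ?_
    exact (quantizationError_genPareto_le_iff hκ hr hκr hne hgrid).1
      (hmin _ hgrid (card_quantizerGrid_le κ p q n))
  · rintro rfl
    refine ⟨hgrid, card_quantizerGrid_le κ p q n, fun β hβ hcard => ?_⟩
    rw [quantizationError_genPareto_le_iff hκ hr hκr hgrid hβ]
    by_contra! hlt
    rw [h.eq_quantizerGrid_of_distortion_le hκ hr hκr n hβ hcard hlt.le] at hlt
    exact hlt.false

theorem IsGridParam.isOptimalQuantizer_map_genPareto_iff {p q : ℕ → ℝ} (h : IsGridParam κ r p q)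
    (hκ : 0 ≤ κ) (hr : 0 < r) (hκr : κ * r < 1) {c : ℝ} (hc : c ≠ 0) (d : ℝ) {n : ℕ}
    {α : Finset ℝ} :
    IsOptimalQuantizer r ((genPareto κ).map fun x => d + c • x) (n + 1) α ↔
      α = d +ᵥ c • quantizerGrid κ p q n := by
  obtain ⟨β, rfl⟩ := (bijective_vadd_smul hc d).surjective α
  rw [isOptimalQuantizer_map_vadd_smul_iff hc, h.isOptimalQuantizer_genPareto_iff hκ hr hκr]
  exact (bijective_vadd_smul hc d).injective.eq_iff.symm

/-- The parameter of the largest point of the grid with `n + 1` points given by `p` and `q`. -/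
def radiusParam (p q : ℕ → ℝ) : ℕ → ℝ
  | 0 => p 0
  | n + 1 => radiusParam p q n + (p (n + 1) + q n)

theorem IsGridParam.isGreatest_quantizerGrid {p q : ℕ → ℝ} (h : IsGridParam κ r p q) (n : ℕ) :
    IsGreatest (quantizerGrid κ p q n : Set ℝ) (stretch κ (radiusParam p q n)) := by
  induction n with
  | zero => simp [quantizerGrid, radiusParam]
  | succ n ih =>
    have hrest := isGreatest_vadd_smul (Real.exp_pos (κ * (p (n + 1) + q n))).le
      (stretch κ (p (n + 1) + q n)) ih
    rw [← stretch_add, add_comm _ (radiusParam p q n)] at hrest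
    have hpos : 0 < stretch κ (radiusParam p q n) := h.pos_of_mem_quantizerGrid n ih.1
    have hle : stretch κ (p (n + 1)) ≤ stretch κ (radiusParam p q n + (p (n + 1) + q n)) := by
      have hR : 0 < radiusParam p q n := (strictMono_stretch κ).lt_iff_lt.1 (by rwa [stretch_zero])
      exact (strictMono_stretch κ).monotone (by linarith [h.q_pos n])
    rw [quantizerGrid, prependPoint, Finset.coe_insert, radiusParam]
    have hinsert := hrest.insert (stretch κ (p (n + 1)))
    rwa [max_eq_right hle] at hinsert

theorem maximalRadius_eq_of_isGreatest {α : Finset ℝ} {b : ℝ} (hα : ∀ a ∈ α, 0 ≤ a)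
    (hb : IsGreatest (α : Set ℝ) b) : maximalRadius α = b := by
  have hsup : α.sup (fun a => ‖a‖₊) = ‖b‖₊ := by
    refine le_antisymm (Finset.sup_le fun a ha => ?_) (Finset.le_sup (f := fun a => ‖a‖₊) hb.1)
    rw [← NNReal.coe_le_coe, coe_nnnorm, coe_nnnorm]
    exact abs_le_abs_of_nonneg (hα a ha) (hb.2 ha)
  rw [maximalRadius, hsup, coe_nnnorm, Real.norm_of_nonneg (hα b hb.1)]

theorem IsGridParam.maximalRadius_eq {p q : ℕ → ℝ} (h : IsGridParam κ r p q) {c d : ℝ} (hc : 0 ≤ c)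
    (hd : 0 ≤ d) (n : ℕ) :
    maximalRadius (d +ᵥ c • quantizerGrid κ p q n) = d + c * stretch κ (radiusParam p q n) := by
  refine maximalRadius_eq_of_isGreatest (fun a ha => ?_)
    (isGreatest_vadd_smul hc d (h.isGreatest_quantizerGrid n))
  refine le_trans ?_ ((isLeast_vadd_smul hc d (h.isLeast_quantizerGrid n)).2 ha)
  have := stretch_pos (κ := κ) (h.p_pos n)
  positivity

end GenPareto

section QuadraticExpansion

open scoped Topology

/-- `f s = 1 + a s + b s ^ 2 + O (s ^ 3)` for some `b`, as `s → 0`, `s ≠ 0`: the accuracy to which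
the recursion of the optimal grids has to be known. The value `f 0` is irrelevant. -/
def HasQuadraticExpansion (f : ℝ → ℝ) (a : ℝ) : Prop :=
  ∃ b : ℝ, (fun s => f s - (1 + a * s + b * s ^ 2)) =O[𝓝[≠] 0] fun s => s ^ 3

theorem isBigO_pow_pow_of_lt {m n : ℕ} (h : m < n) :
    (fun s : ℝ => s ^ n) =O[𝓝[≠] 0] fun s => s ^ m :=
  (isLittleO_pow_pow h).isBigO.mono nhdsWithin_le_nhds

namespace HasQuadraticExpansion

variable {f g : ℝ → ℝ} {a a' : ℝ}

theorem congr (hf : HasQuadraticExpansion f a) (h : ∀ s, s ≠ 0 → f s = g s) :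
    HasQuadraticExpansion g a := by
  obtain ⟨b, hb⟩ := hf
  refine ⟨b, hb.congr' ?_ EventuallyEq.rfl⟩
  filter_upwards [self_mem_nhdsWithin] with s hs
  rw [h s hs]

theorem sub_linear (h : HasQuadraticExpansion f a) :
    (fun s => f s - (1 + a * s)) =O[𝓝[≠] 0] fun s => s ^ 2 := by
  obtain ⟨b, hb⟩ := h
  have hquad := (isBigO_refl (fun s : ℝ => s ^ 2) (𝓝[≠] 0)).const_mul_left b
  exact ((hb.trans (isBigO_pow_pow_of_lt (by norm_num))).add hquad).congr_left fun s => by ring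

theorem sub_one (h : HasQuadraticExpansion f a) :
    (fun s => f s - 1) =O[𝓝[≠] 0] fun s => s := by
  have hlin := (isBigO_refl (fun s : ℝ => s) (𝓝[≠] 0)).const_mul_left a
  have hquad : (fun s : ℝ => s ^ 2) =O[𝓝[≠] 0] fun s => s := by
    simpa using isBigO_pow_pow_of_lt (m := 1) (n := 2) (by norm_num)
  exact ((h.sub_linear.trans hquad).add hlin).congr_left fun s => by ring

theorem tendsto (h : HasQuadraticExpansion f a) : Tendsto f (𝓝[≠] 0) (𝓝 1) := by
  have hzero : Tendsto (fun s => f s - 1) (𝓝[≠] 0) (𝓝 0) :=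
    h.sub_one.trans_tendsto (tendsto_id.mono_left nhdsWithin_le_nhds)
  simpa using hzero.add_const 1

theorem mul (hf : HasQuadraticExpansion f a) (hg : HasQuadraticExpansion g a') :
    HasQuadraticExpansion (fun s => f s * g s) (a + a') := by
  have hg_one := hg.tendsto.isBigO_one ℝ
  obtain ⟨b, hb⟩ := hf
  obtain ⟨b', hb'⟩ := hg
  refine ⟨b + b' + a * a', ?_⟩
  have hpoly : (fun s : ℝ => 1 + a * s + b * s ^ 2) =O[𝓝[≠] 0] fun _ => (1 : ℝ) :=
    ((by fun_prop : Continuous fun s : ℝ => 1 + a * s + b * s ^ 2).tendsto 0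
      |>.mono_left nhdsWithin_le_nhds).isBigO_one ℝ
  have hcubic := (isBigO_refl (fun s : ℝ => s ^ 3) (𝓝[≠] 0)).const_mul_left (a * b' + a' * b)
  have hquartic := (isBigO_pow_pow_of_lt (show 3 < 4 by norm_num)).const_mul_left (b * b')
  have hf' : (fun s => (f s - (1 + a * s + b * s ^ 2)) * g s) =O[𝓝[≠] 0] fun s => s ^ 3 := by
    simpa using hb.mul hg_one
  have hg' : (fun s => (1 + a * s + b * s ^ 2) * (g s - (1 + a' * s + b' * s ^ 2)))
      =O[𝓝[≠] 0] fun s => s ^ 3 := by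
    simpa using hpoly.mul hb'
  exact ((hf'.add hg').add (hcubic.add hquartic)).congr_left fun s => by ring

theorem sub_mul (hf : HasQuadraticExpansion f a) (hg : HasQuadraticExpansion g a') (k : ℝ) :
    HasQuadraticExpansion (fun s => f s - k * (s * g s)) (a - k) := by
  have hlin := (isBigO_refl (fun s : ℝ => s) (𝓝[≠] 0)).mul hg.sub_linear
  obtain ⟨b, hb⟩ := hf
  refine ⟨b - k * a', (hb.sub ((hlin.congr_right fun s => ?_).const_mul_left k)).congr_left
    fun s => ?_⟩ <;> ring

theorem rpow (hf : HasQuadraticExpansion f a) (y : ℝ) :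
    HasQuadraticExpansion (fun s => f s ^ y) (y * a) := by
  have htaylor := (Real.one_add_rpow_hasFPowerSeriesAt_zero (a := y)).isBigO_sub_partialSum_pow 3
  set k := Ring.choose y 2
  have htaylor' : (fun x : ℝ => (1 + x) ^ y - (1 + y * x + k * x ^ 2)) =O[𝓝 0] fun x => x ^ 3 := by
    refine (htaylor.trans ((isBigO_norm_left.2 (isBigO_refl (fun x : ℝ => x ^ 3) (𝓝 0))).congr_left
      fun x => norm_pow x 3)).congr_left fun x => ?_
    simp only [zero_add, FormalMultilinearSeries.partialSum, Finset.sum_range_succ,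
      Finset.sum_range_zero, binomialSeries_apply]
    simp [k, pow_two]
  have hzero : Tendsto (fun s => f s - 1) (𝓝[≠] 0) (𝓝 0) := by
    simpa using hf.tendsto.sub_const 1
  have hcomp := (htaylor'.comp_tendsto hzero).trans (hf.sub_one.pow 3)
  have hsq : (fun s => (f s - 1) ^ 2 - a ^ 2 * s ^ 2) =O[𝓝[≠] 0] fun s => s ^ 3 := by
    have hsum : (fun s => (f s - 1) + a * s) =O[𝓝[≠] 0] fun s => s :=
      hf.sub_one.add ((isBigO_refl _ _).const_mul_left a)
    exact ((hf.sub_linear.mul hsum).congr_left fun s => by ring).congr_right fun s => by ring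
  obtain ⟨b, hb⟩ := hf
  refine ⟨y * b + k * a ^ 2,
    ((hcomp.add (hb.const_mul_left y)).add (hsq.const_mul_left k)).congr_left fun s => ?_⟩
  simp only [Function.comp]
  rw [add_sub_cancel]
  ring

theorem exp_mul (θ : ℝ) : HasQuadraticExpansion (fun s => Real.exp (θ * s)) θ := by
  refine ⟨θ ^ 2 / 2, ?_⟩
  have hzero : Tendsto (fun s : ℝ => θ * s) (𝓝[≠] 0) (𝓝 0) :=
    (Continuous.tendsto' (by fun_prop) _ _ (by simp)).mono_left nhdsWithin_le_nhds
  have htaylor := (Real.exp_sub_sum_range_isBigO_pow 3).comp_tendsto hzero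
  refine (htaylor.congr_left fun s => ?_).trans
    (((isBigO_refl (fun s : ℝ => s ^ 3) (𝓝[≠] 0)).const_mul_left (θ ^ 3)).congr_left fun s => ?_)
  · simp only [Function.comp, Finset.sum_range_succ, Finset.sum_range_zero]
    norm_num [Nat.factorial]
    ring
  · simp only [Function.comp]
    ring

end HasQuadraticExpansion

theorem isBigO_integral_rpow_mul_comp_mul {g : ℝ → ℝ} {n : ℕ} {r : ℝ} (hr : 0 ≤ r)
    (hg : g =O[𝓝[≠] 0] fun s => s ^ n) :
    (fun s => ∫ u in (0 : ℝ)..1, u ^ r * g (s * u)) =O[𝓝[≠] 0] fun s => s ^ n := by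
  obtain ⟨K, hK, hg⟩ := hg.exists_nonneg
  refine IsBigO.of_bound K ?_
  have hg := hg.bound
  rw [eventually_nhdsWithin_iff, Metric.eventually_nhds_iff] at hg ⊢
  obtain ⟨δ, hδ, hg⟩ := hg
  refine ⟨δ, hδ, fun s hsδ hs => ?_⟩
  rw [dist_zero_right] at hsδ
  have hbound : ∀ u ∈ Set.uIoc (0 : ℝ) 1, ‖u ^ r * g (s * u)‖ ≤ K * ‖s ^ n‖ := by
    intro u hu
    rw [Set.uIoc_of_le zero_le_one] at hu
    have hsu : ‖s * u‖ ≤ ‖s‖ := by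
      rw [norm_mul, Real.norm_of_nonneg hu.1.le]
      exact mul_le_of_le_one_right (norm_nonneg s) hu.2
    calc ‖u ^ r * g (s * u)‖ = u ^ r * ‖g (s * u)‖ := by
          rw [norm_mul, Real.norm_of_nonneg (Real.rpow_nonneg hu.1.le r)]
      _ ≤ 1 * (K * ‖(s * u) ^ n‖) := by
          gcongr
          · exact Real.rpow_le_one hu.1.le hu.2 hr
          · exact hg (by rw [dist_zero_right]; exact hsu.trans_lt hsδ) (mul_ne_zero hs hu.1.ne')
      _ ≤ K * ‖s ^ n‖ := by
          rw [one_mul, norm_pow, norm_pow]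
          gcongr
  simpa using intervalIntegral.norm_integral_le_of_norm_le_const hbound

theorem integral_rpow_mul_pow {r : ℝ} (hr : 0 ≤ r) (k : ℕ) :
    ∫ u in (0 : ℝ)..1, u ^ r * u ^ k = 1 / (r + k + 1) := by
  have hpos : 0 < r + k + 1 := by positivity
  have hcongr : ∀ u ∈ Set.uIcc (0 : ℝ) 1, u ^ r * u ^ k = u ^ (r + k) := fun u hu => by
    rw [Set.uIcc_of_le zero_le_one] at hu
    rw [← Real.rpow_natCast, ← Real.rpow_add_of_nonneg hu.1 hr k.cast_nonneg]
  rw [intervalIntegral.integral_congr hcongr, integral_rpow (Or.inl (by linarith)), Real.one_rpow,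
    Real.zero_rpow hpos.ne', sub_zero]

theorem HasQuadraticExpansion.integral {f : ℝ → ℝ} {a r : ℝ} (hf : HasQuadraticExpansion f a)
    (hr : 0 ≤ r)
    (hint : ∀ s, s ≠ 0 → IntervalIntegrable (fun u => u ^ r * f (s * u)) volume 0 1) :
    HasQuadraticExpansion (fun s => (r + 1) * ∫ u in (0 : ℝ)..1, u ^ r * f (s * u))
      ((r + 1) / (r + 2) * a) := by
  obtain ⟨b, hb⟩ := hf
  refine ⟨(r + 1) / (r + 3) * b,
    ((isBigO_integral_rpow_mul_comp_mul hr hb).const_mul_left (r + 1)).congr' ?_ EventuallyEq.rfl⟩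
  filter_upwards [self_mem_nhdsWithin] with s hs
  have hmono : ∀ k : ℕ, IntervalIntegrable (fun u : ℝ => u ^ r * u ^ k) volume 0 1 := fun k =>
    ((Real.continuous_rpow_const hr).mul (continuous_pow k)).intervalIntegrable _ _
  have hpoly : ∀ u : ℝ, u ^ r * (f (s * u) - (1 + a * (s * u) + b * (s * u) ^ 2)) =
      u ^ r * f (s * u) - (u ^ r * u ^ 0 + a * s * (u ^ r * u ^ 1) +
        b * s ^ 2 * (u ^ r * u ^ 2)) := fun u => by ring
  simp only [hpoly]
  rw [intervalIntegral.integral_sub (hint s hs) (((hmono 0).add ((hmono 1).const_mul _)).add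
      ((hmono 2).const_mul _)),
    intervalIntegral.integral_add ((hmono 0).add ((hmono 1).const_mul _)) ((hmono 2).const_mul _),
    intervalIntegral.integral_add (hmono 0) ((hmono 1).const_mul _),
    intervalIntegral.integral_const_mul, intervalIntegral.integral_const_mul,
    integral_rpow_mul_pow hr, integral_rpow_mul_pow hr, integral_rpow_mul_pow hr]
  push_cast
  field_simp
  ring

variable {κ r : ℝ}

theorem stretch_div_eq_integral {s : ℝ} (hs : s ≠ 0) :
    stretch κ s / s = ∫ u in (0 : ℝ)..1, Real.exp (κ * (s * u)) := by
  rw [intervalIntegral.integral_comp_mul_left (fun v => Real.exp (κ * v)) hs, mul_zero, mul_one,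
    smul_eq_mul, stretch, inv_mul_eq_div]

theorem hasQuadraticExpansion_stretch_div (κ : ℝ) :
    HasQuadraticExpansion (fun s => stretch κ s / s) (κ / 2) := by
  have h := (HasQuadraticExpansion.exp_mul κ).integral (r := 0) le_rfl fun s _ =>
    (by simpa using by fun_prop : Continuous fun u : ℝ =>
      u ^ (0 : ℝ) * Real.exp (κ * (s * u))).intervalIntegrable _ _
  simp only [zero_add, Real.rpow_zero, one_mul, one_div_mul_eq_div] at h
  exact h.congr fun s hs => (stretch_div_eq_integral hs).symm

theorem stretch_div_pos {s : ℝ} (hs : s ≠ 0) : 0 < stretch κ s / s := by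
  rcases hs.lt_or_gt with h | h
  · exact div_pos_of_neg_of_neg (stretch_neg_of_neg h) h
  · exact div_pos (stretch_pos h) h

theorem abs_stretch_rpow (κ r : ℝ) {s : ℝ} (hs : s ≠ 0) :
    |stretch κ s| ^ r = |s| ^ r * (stretch κ s / s) ^ r := by
  rw [← Real.mul_rpow (abs_nonneg _) (stretch_div_pos hs).le, ← abs_of_pos (stretch_div_pos hs),
    ← abs_mul, mul_div_cancel₀ _ hs]

theorem exp_mul_abs_stretch_rpow_div (κ r : ℝ) {s u : ℝ} (hs : s ≠ 0) (hu : 0 < u) :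
    Real.exp ((1 - κ * r) * (s * u)) * |stretch κ (s * u)| ^ r / |s| ^ r =
      u ^ r * (Real.exp ((1 - κ * r) * (s * u)) * (stretch κ (s * u) / (s * u)) ^ r) := by
  have hsr : |s| ^ r ≠ 0 := (Real.rpow_pos_of_pos (abs_pos.2 hs) r).ne'
  rw [abs_stretch_rpow κ r (mul_ne_zero hs hu.ne'), abs_mul, abs_of_pos hu,
    Real.mul_rpow (abs_nonneg s) hu.le]
  field_simp

theorem cellMoment_div_eq_integral (κ r : ℝ) {s : ℝ} (hs : s ≠ 0) :
    cellMoment κ r s / (s * |s| ^ r) = ∫ u in (0 : ℝ)..1,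
      u ^ r * (Real.exp ((1 - κ * r) * (s * u)) * (stretch κ (s * u) / (s * u)) ^ r) := by
  have hscale := intervalIntegral.smul_integral_comp_mul_left (a := 0) (b := 1)
    (fun v => Real.exp ((1 - κ * r) * v) * |stretch κ v| ^ r) s
  rw [mul_zero, mul_one, smul_eq_mul] at hscale
  rw [cellMoment, ← hscale, mul_div_mul_left _ _ hs, ← intervalIntegral.integral_div]
  refine intervalIntegral.integral_congr_uIoo fun u hu => ?_
  rw [Set.uIoo_of_le zero_le_one] at hu
  exact exp_mul_abs_stretch_rpow_div κ r hs hu.1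

theorem hasQuadraticExpansion_balance_div (κ : ℝ) (hr : 0 < r) :
    HasQuadraticExpansion (fun s => balance κ r s / |s| ^ r)
      ((1 - κ * r) + r * (κ / 2) - (1 - κ * r) / (r + 1)) := by
  have hintegrand := (HasQuadraticExpansion.exp_mul (1 - κ * r)).mul
    ((hasQuadraticExpansion_stretch_div κ).rpow r)
  have hmoment := hintegrand.integral hr.le fun s hs => by
    have hcont := (((continuous_cellMoment_integrand κ hr).comp
      (continuous_const_mul s)).div_const (|s| ^ r)).intervalIntegrable (μ := volume) 0 1
    refine hcont.congr fun u hu => ?_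
    rw [Set.uIoc_of_le zero_le_one] at hu
    exact exp_mul_abs_stretch_rpow_div κ r hs hu.1
  refine (hintegrand.sub_mul hmoment ((1 - κ * r) / (r + 1))).congr fun s hs => ?_
  have hsr : |s| ^ r ≠ 0 := (Real.rpow_pos_of_pos (abs_pos.2 hs) r).ne'
  rw [← cellMoment_div_eq_integral κ r hs, balance, abs_stretch_rpow κ r hs]
  field_simp

end QuadraticExpansion

section InverseDifferences

open scoped Topology

variable {ι : Type*} {l : Filter ι} {x y : ι → ℝ}

theorem isBigO_sub_of_inv_sub_inv (hx : ∀ i, x i ≠ 0) (hy : ∀ i, y i ≠ 0)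
    (h : (fun i => (x i)⁻¹ - (y i)⁻¹) =O[l] fun _ => (1 : ℝ)) :
    (fun i => x i - y i) =O[l] fun i => x i * y i := by
  refine ((h.mul (isBigO_refl (fun i => x i * y i) l)).neg_left.congr_left fun i => ?_).congr_right
    fun _ => one_mul _
  have := hx i
  have := hy i
  field_simp
  ring

theorem isTheta_of_inv_sub_inv (hx : ∀ i, x i ≠ 0) (hy : ∀ i, y i ≠ 0) (hy0 : Tendsto y l (𝓝 0))
    (h : (fun i => (x i)⁻¹ - (y i)⁻¹) =O[l] fun _ => (1 : ℝ)) : x =Θ[l] y := by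
  have hsmall : (fun i => x i * y i) =o[l] x := by
    simpa using (isBigO_refl x l).mul_isLittleO ((isLittleO_one_iff ℝ).2 hy0)
  exact (IsEquivalent.isTheta
    (((isBigO_sub_of_inv_sub_inv hx hy h).trans_isLittleO hsmall).symm : y ~[l] x)).symm

theorem isBigO_sub_sq_of_inv_sub_inv (hx : ∀ i, x i ≠ 0) (hy : ∀ i, y i ≠ 0)
    (hy0 : Tendsto y l (𝓝 0)) (h : (fun i => (x i)⁻¹ - (y i)⁻¹) =O[l] fun _ => (1 : ℝ)) :
    (fun i => x i - y i) =O[l] fun i => y i ^ 2 :=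
  ((isBigO_sub_of_inv_sub_inv hx hy h).trans ((isTheta_of_inv_sub_inv hx hy hy0 h).1.mul
    (isBigO_refl y l))).congr_right fun _ => (pow_two _).symm

namespace HasQuadraticExpansion

variable {f : ℝ → ℝ} {a : ℝ}

theorem exists_div_self (hf : HasQuadraticExpansion f a) :
    ∃ b, (fun s => f s / s - (s⁻¹ + a + b * s)) =O[𝓝[≠] 0] fun s => s ^ 2 := by
  obtain ⟨b, hb⟩ := hf
  refine ⟨b, (hb.mul (isBigO_refl (fun s => s⁻¹) _)).congr' ?_ ?_⟩ <;>
  · filter_upwards [self_mem_nhdsWithin] with s hs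
    have : s ≠ 0 := hs
    field_simp

theorem isBigO_inv_sub_inv (hf : HasQuadraticExpansion f a) (hx : ∀ i, x i ≠ 0)
    (hy : ∀ i, y i ≠ 0) (hx0 : Tendsto x l (𝓝 0)) (hy0 : Tendsto y l (𝓝 0))
    (h : ∀ i, f (x i) / x i = f (-y i) / y i) :
    (fun i => (x i)⁻¹ - (y i)⁻¹ + 2 * a) =O[l] fun i => y i ^ 2 := by
  obtain ⟨b, hb⟩ := hf.exists_div_self
  have hremx := hb.comp_tendsto (tendsto_nhdsWithin_iff.2 ⟨hx0, Eventually.of_forall hx⟩)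
  have hremy := hb.comp_tendsto (tendsto_nhdsWithin_iff.2
    ⟨by simpa using hy0.neg, Eventually.of_forall fun i => neg_ne_zero.2 (hy i)⟩)
  simp only [Function.comp_def, neg_sq, div_neg, inv_neg, ← h] at hremx hremy
  have hbounded : (fun i => (x i)⁻¹ - (y i)⁻¹) =O[l] fun _ => (1 : ℝ) := by
    have hxsq : (fun i => x i ^ 2) =O[l] fun _ => (1 : ℝ) := (hx0.pow 2).isBigO_one ℝ
    have hysq : (fun i => y i ^ 2) =O[l] fun _ => (1 : ℝ) := (hy0.pow 2).isBigO_one ℝ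
    have hlin := ((hx0.sub hy0).const_mul b).isBigO_one ℝ
    exact (((hremx.trans hxsq).add (hremy.trans hysq)).neg_left.sub
      (hlin.add (isBigO_const_one ℝ (2 * a) l))).congr_left fun i => by ring
  have hxy := (isTheta_of_inv_sub_inv hx hy hy0 hbounded).1.pow 2
  exact (((hremx.trans hxy).add hremy).neg_left.sub
    ((isBigO_sub_sq_of_inv_sub_inv hx hy hy0 hbounded).const_mul_left b)).congr_left
    fun i => by ring

end HasQuadraticExpansion

end InverseDifferences

section Sequences

open scoped Topology

theorem exists_isBigO_sub_of_isBigO_sub_succ {u b : ℕ → ℝ} (hb : Antitone b)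
    (hb0 : Tendsto b atTop (𝓝 0))
    (h : (fun n => u (n + 1) - u n) =O[atTop] fun n => b n - b (n + 1)) :
    ∃ C, (fun n => u n - C) =O[atTop] b := by
  obtain ⟨K, hK, h⟩ := h.exists_nonneg
  obtain ⟨N, hN⟩ := eventually_atTop.1 h.bound
  have hdist : ∀ n m, N ≤ n → n ≤ m → dist (u n) (u m) ≤ K * b n := by
    intro n m hn hm
    calc dist (u n) (u m) ≤ ∑ i ∈ Finset.Ico n m, K * (b i - b (i + 1)) :=
          dist_le_Ico_sum_of_dist_le hm fun {i} hi _ => by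
            rw [dist_comm, dist_eq_norm]
            simpa [abs_of_nonneg (sub_nonneg.2 (hb i.le_succ))] using hN i (hn.trans hi)
      _ = K * (b n - b m) := by
          have htelescope := Finset.sum_Ico_sub (fun i => -b i) hm
          simp only [neg_sub_neg] at htelescope
          rw [← Finset.mul_sum, htelescope]
      _ ≤ K * b n := by
          gcongr
          exact sub_le_self _ (hb.le_of_tendsto hb0 m)
  have hcauchy : CauchySeq u := (cauchySeq_shift N).1 <|
    cauchySeq_of_le_tendsto_0' (fun n => K * b (n + N))
      (fun n m hnm => hdist _ _ (Nat.le_add_left N n) (by gcongr))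
      (by simpa using ((tendsto_add_atTop_iff_nat N).2 hb0).const_mul K)
  obtain ⟨C, hC⟩ := cauchySeq_tendsto_of_complete hcauchy
  refine ⟨C, IsBigO.of_bound K ?_⟩
  filter_upwards [eventually_ge_atTop N] with n hn
  rw [← dist_eq_norm, Real.norm_of_nonneg (hb.le_of_tendsto hb0 n)]
  exact le_of_tendsto (tendsto_const_nhds.dist hC)
    ((eventually_ge_atTop n).mono fun m hm => hdist n m hn hm)

theorem exists_isBigO_sub_one_div {u : ℕ → ℝ}
    (h : (fun n => u (n + 1) - u n) =O[atTop] fun n : ℕ => (1 / ((n : ℝ) + 1)) ^ 2) :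
    ∃ C, (fun n => u n - C) =O[atTop] fun n : ℕ => 1 / ((n : ℝ) + 1) := by
  refine exists_isBigO_sub_of_isBigO_sub_succ (antitone_nat_of_succ_le fun n => ?_)
    tendsto_one_div_add_atTop_nhds_zero_nat (h.trans (IsBigO.of_bound 2 (Eventually.of_forall ?_)))
  · push_cast
    gcongr
    simp
  · intro n
    have hdiff : 1 / ((n : ℝ) + 1) - 1 / (((n + 1 : ℕ) : ℝ) + 1) =
        1 / ((n + 1) * (n + 2)) := by
      push_cast
      field_simp
      ring
    rw [hdiff, Real.norm_of_nonneg (by positivity), Real.norm_of_nonneg (by positivity),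
      one_div_pow, mul_one_div, div_le_div_iff₀ (by positivity) (by positivity)]
    nlinarith [n.cast_nonneg (α := ℝ)]

theorem tendsto_div_of_tendsto_sub_succ {u : ℕ → ℝ} {c : ℝ}
    (h : Tendsto (fun n => u (n + 1) - u n) atTop (𝓝 c)) :
    Tendsto (fun n : ℕ => u n / ((n : ℝ) + 1)) atTop (𝓝 c) := by
  have hmean := (h.cesaro.mul (tendsto_natCast_div_add_atTop (1 : ℝ))).add
    (tendsto_one_div_add_atTop_nhds_zero_nat.const_mul (u 0))
  rw [mul_one, mul_zero, add_zero] at hmean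
  refine hmean.congr' ?_
  filter_upwards [eventually_ne_atTop 0] with n hn
  rw [Finset.sum_range_sub]
  field_simp
  ring

theorem isBigO_one_div_of_tendsto_inv_sub_inv {x : ℕ → ℝ} {c : ℝ} (hc : c ≠ 0)
    (h : Tendsto (fun n => (x (n + 1))⁻¹ - (x n)⁻¹) atTop (𝓝 c)) :
    x =O[atTop] fun n : ℕ => 1 / ((n : ℝ) + 1) := by
  have hprod := ((tendsto_div_of_tendsto_sub_succ (u := fun n => (x n)⁻¹) h).inv₀ hc).isBigO_one ℝ
  refine ((hprod.mul (isBigO_refl (fun n : ℕ => 1 / ((n : ℝ) + 1)) atTop)).congr_left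
    fun n => ?_).congr_right fun _ => one_mul _
  rw [inv_div, div_inv_eq_mul]
  field_simp

theorem isBigO_inv_sub_mul_of_isBigO_inv_sub_inv {x : ℕ → ℝ} {c : ℝ} (hc : c ≠ 0)
    (hx0 : Tendsto x atTop (𝓝 0))
    (h : (fun n => (x (n + 1))⁻¹ - (x n)⁻¹ - c) =O[atTop] fun n => x n ^ 2) :
    (fun n : ℕ => (x n)⁻¹ - c * ((n : ℝ) + 1)) =O[atTop] fun _ => (1 : ℝ) := by
  have hlim : Tendsto (fun n => (x (n + 1))⁻¹ - (x n)⁻¹) atTop (𝓝 c) := by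
    simpa using (h.trans_tendsto (by simpa using hx0.pow 2)).add_const c
  obtain ⟨C, hC⟩ := exists_isBigO_sub_one_div (u := fun n => (x n)⁻¹ - c * ((n : ℝ) + 1)) <|
    (h.trans ((isBigO_one_div_of_tendsto_inv_sub_inv hc hlim).pow 2)).congr_left fun n => by
      push_cast
      ring
  exact ((hC.trans (tendsto_one_div_add_atTop_nhds_zero_nat.isBigO_one ℝ)).add
    (isBigO_const_one ℝ C atTop)).congr_left fun n => sub_add_cancel _ _

theorem isBigO_sub_one_div_of_isBigO_inv_sub {x : ℕ → ℝ} {c : ℝ} (hc : c ≠ 0) (hx : ∀ n, x n ≠ 0)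
    (h : (fun n : ℕ => (x n)⁻¹ - c * ((n : ℝ) + 1)) =O[atTop] fun _ => (1 : ℝ)) :
    (fun n : ℕ => x n - 1 / c * (1 / ((n : ℝ) + 1))) =O[atTop]
      fun n : ℕ => (1 / ((n : ℝ) + 1)) ^ 2 := by
  have hlim : Tendsto (fun n : ℕ => 1 / c * (1 / ((n : ℝ) + 1))) atTop (𝓝 0) := by
    simpa using tendsto_one_div_add_atTop_nhds_zero_nat.const_mul (1 / c)
  refine (isBigO_sub_sq_of_inv_sub_inv hx (fun n => by positivity) hlim
    (h.congr_left fun n => ?_)).trans ?_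
  · simp [mul_comm]
  · simp only [mul_pow]
    exact (isBigO_refl _ _).const_mul_left _

theorem abs_log_one_add_sub_self_le {x : ℝ} (hx : 0 ≤ x) : |Real.log (1 + x) - x| ≤ x ^ 2 := by
  have hlower := Real.le_log_one_add_of_nonneg hx
  have hupper := Real.log_le_sub_one_of_pos (show 0 < 1 + x by positivity)
  have hgap : x - 2 * x / (x + 2) ≤ x ^ 2 := by
    rw [show x - 2 * x / (x + 2) = x ^ 2 / (x + 2) by field_simp; ring]
    exact div_le_self (sq_nonneg x) (by linarith)
  rw [abs_of_nonpos (by linarith)]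
  linarith

theorem isBigO_log_succ_sub_log :
    (fun n : ℕ => Real.log ((n : ℝ) + 1 + 1) - Real.log ((n : ℝ) + 1) - 1 / ((n : ℝ) + 1))
      =O[atTop] fun n : ℕ => (1 / ((n : ℝ) + 1)) ^ 2 := by
  refine IsBigO.of_norm_le fun n => ?_
  rw [← Real.log_div (by positivity) (by positivity), add_div, div_self (by positivity)]
  exact abs_log_one_add_sub_self_le (by positivity)

end Sequences

section RadiusAsymptotics

open scoped Topology

namespace IsGridParam

variable {κ r : ℝ} {p q : ℕ → ℝ}

theorem q_succ_lt (h : IsGridParam κ r p q) (hr : 0 < r) (hκr : κ * r < 1) (n : ℕ) :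
    q (n + 1) < q n := by
  have hlt := strictMono_stretch κ (h.p_succ_lt hr hκr n)
  rw [← h.neg_stretch_neg, ← h.neg_stretch_neg, neg_lt_neg_iff,
    (strictMono_stretch κ).lt_iff_lt, neg_lt_neg_iff] at hlt
  exact hlt

theorem tendsto_zero (h : IsGridParam κ r p q) (hr : 0 < r) (hκr : κ * r < 1) :
    Tendsto p atTop (𝓝 0) ∧ Tendsto q atTop (𝓝 0) := by
  have hp := tendsto_atTop_ciInf (antitone_nat_of_succ_le fun n => (h.p_succ_lt hr hκr n).le)
    ⟨0, by rintro _ ⟨n, rfl⟩; exact (h.p_pos n).le⟩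
  have hq := tendsto_atTop_ciInf (antitone_nat_of_succ_le fun n => (h.q_succ_lt hr hκr n).le)
    ⟨0, by rintro _ ⟨n, rfl⟩; exact (h.q_pos n).le⟩
  set x := ⨅ n, p n
  set y := ⨅ n, q n
  have hx : 0 ≤ x := ge_of_tendsto' hp fun n => (h.p_pos n).le
  have hy : 0 ≤ y := ge_of_tendsto' hq fun n => (h.q_pos n).le
  have hstretch : -stretch κ (-y) = stretch κ x := by
    refine tendsto_nhds_unique (((continuous_stretch κ).tendsto _ |>.comp hq.neg).neg) ?_
    exact ((continuous_stretch κ).tendsto x |>.comp hp).congr fun n => (h.neg_stretch_neg n).symm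
  have hbalance : balance κ r x = balance κ r (-y) := by
    refine tendsto_nhds_unique ((continuous_balance κ hr).tendsto x |>.comp
      ((tendsto_add_atTop_iff_nat 1).2 hp)) ?_
    exact ((continuous_balance κ hr).tendsto _ |>.comp hq.neg).congr
      fun n => (h.balance_succ n).symm
  have hxy : x = 0 ↔ y = 0 := by
    have hzero : ∀ s, stretch κ s = 0 ↔ s = 0 := fun s =>
      (strictMono_stretch κ).injective.eq_iff' (stretch_zero κ)
    rw [← hzero x, ← hstretch, neg_eq_zero, hzero, neg_eq_zero]
  have hx0 : x = 0 := by
    by_contra hne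
    exact (stretch_lt_of_balance_eq hr hκr (hx.lt_of_ne' hne) (hy.lt_of_ne' (mt hxy.2 hne))
      hbalance).ne' hstretch
  exact ⟨hx0 ▸ hp, hxy.1 hx0 ▸ hq⟩

theorem isBigO_inv_p_sub_inv_q (h : IsGridParam κ r p q) (hr : 0 < r) (hκr : κ * r < 1) :
    (fun n => (p n)⁻¹ - (q n)⁻¹ - κ) =O[atTop] fun n => q n ^ 2 := by
  obtain ⟨hp0, hq0⟩ := h.tendsto_zero hr hκr
  have hexp := ((hasQuadraticExpansion_stretch_div κ).rpow (-1)).isBigO_inv_sub_inv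
    (fun n => (h.p_pos n).ne') (fun n => (h.q_pos n).ne') hp0 hq0 fun n => by
      have hp := (h.p_pos n).ne'
      have hq := (h.q_pos n).ne'
      rw [Real.rpow_neg_one, Real.rpow_neg_one, ← h.neg_stretch_neg n]
      field_simp
  exact hexp.congr_left fun n => by ring

theorem isBigO_inv_p_succ_sub_inv_q (h : IsGridParam κ r p q) (hr : 0 < r) (hκr : κ * r < 1) :
    (fun n => (p (n + 1))⁻¹ - (q n)⁻¹ - (2 * (1 - κ * r) / (r + 1) + κ)) =O[atTop]
      fun n => q n ^ 2 := by
  obtain ⟨hp0, hq0⟩ := h.tendsto_zero hr hκr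
  have hrpow : ∀ {s b : ℝ}, 0 < s → 0 ≤ b → (b / s ^ r) ^ (-(1 / r)) / s = b ^ (-(1 / r)) := by
    intro s b hs hb
    rw [Real.div_rpow hb (Real.rpow_nonneg hs.le r), ← Real.rpow_mul hs.le,
      show r * -(1 / r) = -1 by field_simp, Real.rpow_neg_one]
    field_simp
  have hexp := ((hasQuadraticExpansion_balance_div κ hr).rpow (-(1 / r))).isBigO_inv_sub_inv
    (fun n => (h.p_pos (n + 1)).ne') (fun n => (h.q_pos n).ne')
    ((tendsto_add_atTop_iff_nat 1).2 hp0) hq0 fun n => by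
      have hbal := (balance_pos_of_neg hr hκr (neg_lt_zero.2 (h.q_pos n))).le
      rw [abs_neg, abs_of_pos (h.p_pos (n + 1)), abs_of_pos (h.q_pos n), h.balance_succ n,
        hrpow (h.p_pos (n + 1)) hbal, hrpow (h.q_pos n) hbal]
  refine hexp.congr_left fun n => ?_
  field_simp
  ring

theorem isBigO_inv_q_sub (h : IsGridParam κ r p q) (hr : 0 < r) (hκr : κ * r < 1) :
    (fun n : ℕ => (q n)⁻¹ - 2 * (1 - κ * r) / (r + 1) * ((n : ℝ) + 1)) =O[atTop]
      fun _ => (1 : ℝ) := by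
  obtain ⟨hp0, hq0⟩ := h.tendsto_zero hr hκr
  have hq_sq : (fun n => q n ^ 2) =O[atTop] fun _ => (1 : ℝ) := (hq0.pow 2).isBigO_one ℝ
  have hpq := h.isBigO_inv_p_sub_inv_q hr hκr
  have hbounded : (fun n => (p n)⁻¹ - (q n)⁻¹) =O[atTop] fun _ => (1 : ℝ) :=
    ((hpq.trans hq_sq).add (isBigO_const_one ℝ κ atTop)).congr_left fun n => sub_add_cancel _ _
  have hθ := isTheta_of_inv_sub_inv (fun n => (h.p_pos n).ne') (fun n => (h.q_pos n).ne') hq0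
    hbounded
  have hstep : (fun n => (p (n + 1))⁻¹ - (p n)⁻¹ - 2 * (1 - κ * r) / (r + 1)) =O[atTop]
      fun n => p n ^ 2 :=
    (((h.isBigO_inv_p_succ_sub_inv_q hr hκr).sub hpq).congr_left fun n => by ring).trans
      (hθ.2.pow 2)
  have hc : 2 * (1 - κ * r) / (r + 1) ≠ 0 := (div_pos (by linarith) (by linarith)).ne'
  exact ((isBigO_inv_sub_mul_of_isBigO_inv_sub_inv hc hp0 hstep).sub hbounded).congr_left
    fun n => by ring

theorem isBigO_p_succ_add_q_sub (h : IsGridParam κ r p q) (hr : 0 < r) (hκr : κ * r < 1) :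
    (fun n : ℕ => p (n + 1) + q n - (r + 1) / (1 - κ * r) * (1 / ((n : ℝ) + 1))) =O[atTop]
      fun n : ℕ => (1 / ((n : ℝ) + 1)) ^ 2 := by
  have hθ : 0 < 1 - κ * r := by linarith
  have hc : 2 * (1 - κ * r) / (r + 1) ≠ 0 := by positivity
  have hq_sq : (fun n => q n ^ 2) =O[atTop] fun _ => (1 : ℝ) :=
    ((h.tendsto_zero hr hκr).2.pow 2).isBigO_one ℝ
  have hinv_q := h.isBigO_inv_q_sub hr hκr
  have hinv_p : (fun n : ℕ => (p (n + 1))⁻¹ - 2 * (1 - κ * r) / (r + 1) * ((n : ℝ) + 1))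
      =O[atTop] fun _ => (1 : ℝ) :=
    ((((h.isBigO_inv_p_succ_sub_inv_q hr hκr).trans hq_sq).add (isBigO_const_one ℝ
      (2 * (1 - κ * r) / (r + 1) + κ) atTop)).add hinv_q).congr_left fun n => by ring
  refine ((isBigO_sub_one_div_of_isBigO_inv_sub hc (fun n => (h.p_pos (n + 1)).ne') hinv_p).add
    (isBigO_sub_one_div_of_isBigO_inv_sub hc (fun n => (h.q_pos n).ne') hinv_q)).congr_left
    fun n => ?_
  field_simp
  ring

theorem exists_radiusParam_isBigO (h : IsGridParam κ r p q) (hr : 0 < r) (hκr : κ * r < 1) :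
    ∃ C, (fun n : ℕ => radiusParam p q n -
      ((r + 1) / (1 - κ * r) * Real.log ((n : ℝ) + 1) + C)) =O[atTop]
        fun n : ℕ => 1 / ((n : ℝ) + 1) := by
  obtain ⟨C, hC⟩ := exists_isBigO_sub_one_div
    (u := fun n : ℕ => radiusParam p q n - (r + 1) / (1 - κ * r) * Real.log ((n : ℝ) + 1)) <|
    ((h.isBigO_p_succ_add_q_sub hr hκr).sub
      (isBigO_log_succ_sub_log.const_mul_left ((r + 1) / (1 - κ * r)))).congr_left fun n => by
        rw [radiusParam]
        push_cast
        ring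
  exact ⟨C, hC.congr_left fun n => by ring⟩

end IsGridParam

end RadiusAsymptotics

section OptimalRadius

variable {κ r : ℝ} {p q : ℕ → ℝ} {c d : ℝ} {n : ℕ}

theorem IsGridParam.existsUnique_isOptimalQuantizer (h : IsGridParam κ r p q) (hκ : 0 ≤ κ)
    (hr : 0 < r) (hκr : κ * r < 1) (hc : c ≠ 0) (d : ℝ) (hn : 1 ≤ n) :
    ∃! α, IsOptimalQuantizer r ((genPareto κ).map fun x => d + c • x) n α := by
  obtain ⟨m, rfl⟩ := Nat.exists_eq_add_of_le' hn
  simp only [h.isOptimalQuantizer_map_genPareto_iff hκ hr hκr hc d]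
  exact existsUnique_eq

theorem IsGridParam.maximalRadius_of_isOptimalQuantizer (h : IsGridParam κ r p q) (hκ : 0 ≤ κ)
    (hr : 0 < r) (hκr : κ * r < 1) (hc : 0 < c) (hd : 0 ≤ d) {α : Finset ℝ}
    (hα : IsOptimalQuantizer r ((genPareto κ).map fun x => d + c • x) (n + 1) α) :
    maximalRadius α = d + c * stretch κ (radiusParam p q n) := by
  rw [(h.isOptimalQuantizer_map_genPareto_iff hκ hr hκr hc.ne' d).1 hα,
    h.maximalRadius_eq hc.le hd]

theorem optimalQuantizer_genPareto_asymptotics (hκ : 0 ≤ κ) (hr : 0 < r)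
    (hκr : κ * r < 1) :
    ∃ (s : ℕ → ℝ) (C : ℝ),
      ((fun n : ℕ => s n - ((r + 1) / (1 - κ * r) * Real.log n + C)) =O[atTop]
        fun n : ℕ => 1 / (n : ℝ)) ∧
      ∀ c d : ℝ, 0 < c → 0 ≤ d →
        (∀ n, 1 ≤ n → ∃! α, IsOptimalQuantizer r ((genPareto κ).map fun x => d + c • x) n α) ∧
        ∀ n α, 1 ≤ n → IsOptimalQuantizer r ((genPareto κ).map fun x => d + c • x) n α →
          maximalRadius α = d + c * stretch κ (s n) := by
  obtain ⟨p, q, h⟩ := exists_isGridParam hκ hr hκr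
  obtain ⟨C, hC⟩ := h.exists_radiusParam_isBigO hr hκr
  refine ⟨fun n => radiusParam p q (n - 1), C, ?_, fun c d hc hd =>
    ⟨fun n => h.existsUnique_isOptimalQuantizer hκ hr hκr hc.ne' d, fun n α hn hα => ?_⟩⟩
  · rw [← map_add_atTop_eq_nat 1, isBigO_map]
    simpa [Function.comp_def] using hC
  · obtain ⟨m, rfl⟩ := Nat.exists_eq_add_of_le' hn
    exact h.maximalRadius_of_isOptimalQuantizer hκ hr hκr hc hd hα

end OptimalRadius

theorem mainTheorem10 (r : ℝ) (hr : 0 < r) :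
    (∃ C : ℝ, ∀ lam : ℝ, 0 < lam →
      (∀ n : ℕ, 1 ≤ n → ∃! α : Finset ℝ, IsOptimalQuantizer r (expMeasure lam) n α) ∧
      ∀ α : ℕ → Finset ℝ,
        (∀ n : ℕ, 1 ≤ n → IsOptimalQuantizer r (expMeasure lam) n (α n)) →
        (fun n : ℕ => maximalRadius (α n) - ((r + 1) / lam * Real.log (n : ℝ) + C / lam))
          =O[atTop] fun n : ℕ => 1 / (n : ℝ)) ∧
    (∀ γ : ℝ, r < γ → ∃ C : ℝ,
      (∀ n : ℕ, 1 ≤ n → ∃! α : Finset ℝ, IsOptimalQuantizer r (paretoMeasure 1 γ) n α) ∧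
      ∀ α : ℕ → Finset ℝ,
        (∀ n : ℕ, 1 ≤ n → IsOptimalQuantizer r (paretoMeasure 1 γ) n (α n)) →
        (fun n : ℕ => Real.log (maximalRadius (α n)) - ((r + 1) / (γ - r) * Real.log (n : ℝ) + C))
          =O[atTop] fun n : ℕ => 1 / (n : ℝ)) := by
  constructor
  · obtain ⟨s, C, hs, hopt⟩ := optimalQuantizer_genPareto_asymptotics le_rfl hr
      (show 0 * r < 1 by simp)
    refine ⟨C, fun lam hlam => ?_⟩
    obtain ⟨hunique, hradius⟩ := hopt (1 / lam) 0 (one_div_pos.2 hlam) le_rfl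
    rw [← expMeasure_eq_map_genPareto hlam] at hunique hradius
    refine ⟨hunique, fun α hα => (hs.const_mul_left (1 / lam)).congr' ?_ EventuallyEq.rfl⟩
    filter_upwards [eventually_ge_atTop 1] with n hn
    rw [hradius n _ hn (hα n hn), stretch_zero_left]
    ring
  · intro γ hγ
    have hγ_pos : 0 < γ := hr.trans hγ
    have hκ : 0 < 1 / γ := one_div_pos.2 hγ_pos
    obtain ⟨s, C, hs, hopt⟩ := optimalQuantizer_genPareto_asymptotics hκ.le hr
      (show 1 / γ * r < 1 by rwa [one_div_mul_eq_div, div_lt_one hγ_pos])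
    obtain ⟨hunique, hradius⟩ := hopt (1 / γ) 1 hκ zero_le_one
    rw [← paretoMeasure_eq_map_genPareto hγ_pos] at hunique hradius
    refine ⟨1 / γ * C, hunique, fun α hα => (hs.const_mul_left (1 / γ)).congr' ?_ EventuallyEq.rfl⟩
    filter_upwards [eventually_ge_atTop 1] with n hn
    have hscale : 1 / γ * ((r + 1) / (1 - 1 / γ * r)) = (r + 1) / (γ - r) := by
      field_simp
    rw [hradius n _ hn (hα n hn), one_add_mul_stretch, Real.log_exp, ← hscale]
    ring
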